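/- Identify $\mathbb R^2$ with $\mathbb C$ and write $X=Re^{i\theta}$. **The vortex.** Let $0<r_1<r_2$, $0<\varepsilon<\frac13\min\{r_1,r_2-r_1\}$, let $c=(r_2/r_1)^2-1$, and let $\eta\in C_c^\infty(-1,1)$ with $\int\eta=1$, $\eta^\varepsilon(x)=\varepsilon^{-1}\eta(x/\varepsilon)$. Put $v_1(r)=\frac{cr}{2}$, $v_2(r)=\frac r2\big((r_2/r)^2-1\big)$, $\chi=1_{[r_1,r_2)}*\eta^\varepsilon$, and let $$\bar V_\theta(r)=\begin{cases} v_1+(v_2-v_1)\chi, & |r-r_1|<\varepsilon,\\ v_2\,\chi, & |r-r_2|<\varepsilon,\\ v_11_{[0,r_1]}+v_21_{(r_1,r_2]}, & \text{otherwise,}\end{cases}\qquad \bar W(r)=\frac1r\,\partial_r\big(r\bar V_\theta(r)\big)$$ (with $\bar W(0)=c$ by continuity). Let $\bar\Omega(X)=\bar W(|X|)\in C_c^\infty(\mathbb R^2)$, a vortex with zero mean, let $\bar V=\bar V_\theta e_\theta$ be its velocity, and for $b>0$ let $\bar V_b=\bar V-bX$, so that $\mathrm{div}\,\bar V_b=-2b$.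 **The operator.** Let $n\ge2$ and $0<a,b\le1$. Let $L^2_n$ be the space of complex-valued $\Omega\in L^2(\mathbb R^2)$ with $\Omega(e^{2\pi i/n}X)=\Omega(X)$ and zero mean (in the sense $\lim_{R\to\infty}\int_{|X|<R}\Omega=0$), and for $k\in\mathbb Z$ let $U_k=\{\Omega\in L^2:\Omega(X)=\Omega_k(R)e^{ik\theta}\}$. On the domain $D(L_b)=\{\Omega\in L^2_n:\mathrm{div}(\bar V_b\Omega)\in L^2_n\}$ (distributional divergence) let $$L_b\Omega=ab\,\Omega-\bar V_b\cdot\nabla\Omega-V\cdot\nabla\bar\Omega,\qquad \bar V_b\cdot\nabla\Omega=\mathrm{div}(\bar V_b\Omega)+2b\,\Omega,$$ where $V=\nabla^\perp\Delta^{-1}\Omega$ is given by the Biot–Savart law, understood as $$V(X)=\lim_{\rho\to\infty}\frac1{2\pi}\int_{|Y|<\rho}\frac{(X-Y)^\perp}{|X-Y|^2}\,\Omega(Y)\,dY\quad\text{for a.e. }X,\qquad (x_1,x_2)^\perp=(-x_2,x_1).$$ **Hölder classes.** For $\gamma>0$ write $\gamma=k+\alpha$ with $k\in\mathbb N_0$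 and $0<\alpha\le1$. Then $C^\gamma(\mathbb R^2)$ is the space of $C^k$ functions whose derivatives up to order $k$ are bounded and whose derivatives of order $k$ are $\alpha$-Hölder continuous (so $C^\gamma=C^{\gamma-1,1}$ when $\gamma$ is an integer); $C_c^\gamma$ denotes its compactly supported elements. **Proposition.** Let $\lambda\in\mathbb C$ with $\mathrm{Re}\,\lambda>3b$, let $j\in\mathbb Z\setminus\{0\}$, and let $W\in\mathrm{Ker}(L_b-\lambda)\cap U_{jn}$. Then $\gamma:=\frac{\mathrm{Re}\,\lambda}{b}-a\ge2$ and, after modification on a null set, $$W\in C^\infty(\mathbb R^2\setminus\{0\})\cap C_c^\gamma(\mathbb R^2).$$ -/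

import Mathlib

open MeasureTheory Filter Topology
open scoped ContDiff

noncomputable section

/-! The plane is identified with `ℂ`, `X = R e^{iθ}`; derivatives are real derivatives. -/

/-- Parameters of the regularized vortex: two radii, a regularization length, a mollifier. -/
structure VortexData where
  r₁ : ℝ
  r₂ : ℝ
  ε : ℝ
  η : ℝ → ℝ

namespace VortexData

/-- The constraints `0 < r₁ < r₂`, `0 < ε < min {r₁, r₂ - r₁} / 3`, `η ∈ C_c^∞(-1,1)`, `∫ η = 1`. -/
structure Admissible (P : VortexData) : Prop where
  r₁_pos : 0 < P.r₁
  r₁_lt_r₂ : P.r₁ < P.r₂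
  ε_pos : 0 < P.ε
  ε_lt : P.ε < min P.r₁ (P.r₂ - P.r₁) / 3
  η_smooth : ContDiff ℝ ∞ P.η
  η_supp : tsupport P.η ⊆ Set.Ioo (-1) 1
  η_integral : ∫ x, P.η x = 1

variable (P : VortexData)

/-- The constant `c` with `(1 + c) (r₁ / r₂)² = 1` (zero mean condition). -/
def c : ℝ := (P.r₂ / P.r₁) ^ 2 - 1

/-- Angular velocity on the inner disc. -/
def v₁ (r : ℝ) : ℝ := P.c * r / 2

/-- Angular velocity on the annulus. -/
def v₂ (r : ℝ) : ℝ := r / 2 * ((P.r₂ / r) ^ 2 - 1)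

/-- Angular velocity of the piecewise constant vortex `c 1_{[0,r₁)} - 1_{[r₁,r₂)}`. -/
def vSharp (r : ℝ) : ℝ :=
  if r ≤ P.r₁ then P.v₁ r else if r ≤ P.r₂ then P.v₂ r else 0

/-- The mollified indicator `1_{[r₁,r₂)} * η^ε`, where `η^ε(x) = ε⁻¹ η(x/ε)`. -/
def cutoff (r : ℝ) : ℝ := ∫ s in P.r₁..P.r₂, P.ε⁻¹ * P.η ((r - s) / P.ε)

/-- The regularized angular velocity profile `V̄_θ`. -/
def vθ (r : ℝ) : ℝ :=
  if |r - P.r₁| < P.ε then P.v₁ r + (P.v₂ r - P.v₁ r) * P.cutoff r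
  else if |r - P.r₂| < P.ε then P.v₂ r * P.cutoff r
  else P.vSharp r

/-- The regularized vorticity profile `r⁻¹ ∂_r (r V̄_θ)`. It is identically `c` near `r = 0`,
and this value is assigned at `r = 0`, where the formula is not meaningful. -/
def w (r : ℝ) : ℝ := if r = 0 then P.c else deriv (fun s => s * P.vθ s) r / r

/-- The vortex `Ω̄(X) = W̄(|X|)`. -/
def Ωbar (X : ℂ) : ℝ := P.w ‖X‖

/-- Its velocity `V̄(X) = V̄_θ(|X|) e_θ`, with `e_θ = i X / |X|`. -/
def Vbar (X : ℂ) : ℂ := (P.vθ ‖X‖ : ℂ) * (Complex.I * X / (‖X‖ : ℂ))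

/-- The vector field `V̄_b = V̄ - b X`. -/
def Vb (b : ℝ) (X : ℂ) : ℂ := P.Vbar X - (b : ℂ) * X

end VortexData

/-- `L²_n`: square integrable, `n`-fold symmetric, with zero mean. The mean of an `L²` function is
the improper integral `lim_{R → ∞} ∫_{|X| < R} Ω = 2π ∫_0^∞ Ω_0(R) R dR`. -/
def L2n (n : ℕ) : Set (ℂ → ℂ) :=
  {Ω | MemLp Ω 2 volume ∧
    (∀ᵐ X : ℂ, Ω X = Ω (Complex.exp (2 * Real.pi * Complex.I / n) * X)) ∧
    Tendsto (fun R : ℝ => ∫ X in Metric.ball (0 : ℂ) R, Ω X) atTop (𝓝 0)}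

/-- `U_k`: the functions in `L²` of the form `Ω_k(R) e^{ikθ}`. -/
def U (k : ℤ) : Set (ℂ → ℂ) :=
  {Ω | MemLp Ω 2 volume ∧
    ∃ g : ℝ → ℂ, ∀ᵐ X : ℂ, Ω X = g ‖X‖ * (X / (‖X‖ : ℂ)) ^ k}

/-- The Biot-Savart integral `(2π)⁻¹ ∫_{|Y| < ρ} (X - Y)^⊥ / |X - Y|² Ω(Y) dY` of the part of a
(complex valued) vorticity in a disc, with `(x₁, x₂)^⊥ = (-x₂, x₁)`. -/
def biotSavartTrunc (Ω : ℂ → ℂ) (ρ : ℝ) (X : ℂ) : ℂ × ℂ :=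
  (∫ Y in Metric.ball (0 : ℂ) ρ, ((-(X - Y).im / (2 * Real.pi * ‖X - Y‖ ^ 2) : ℝ) : ℂ) * Ω Y,
   ∫ Y in Metric.ball (0 : ℂ) ρ, (((X - Y).re / (2 * Real.pi * ‖X - Y‖ ^ 2) : ℝ) : ℂ) * Ω Y)

/-- The velocity `V = ∇^⊥ Δ⁻¹ Ω`, as the limit of the velocities of the truncations of `Ω`. For `Ω`
in `L²_n`, `n ≥ 2`, the integral over the plane need not converge absolutely, but the limit exists
almost everywhere (by the symmetry of `Ω`) and is the extension of the Biot-Savart operator by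
density. -/
def velocity (Ω : ℂ → ℂ) (X : ℂ) : ℂ × ℂ :=
  limUnder atTop (fun ρ : ℝ => biotSavartTrunc Ω ρ X)

/-- `D` is the distributional divergence of the vector field `Ω F`. -/
def IsWeakDiv (F : ℂ → ℂ) (Ω D : ℂ → ℂ) : Prop :=
  ∀ φ : ℂ → ℂ, ContDiff ℝ ∞ φ → HasCompactSupport φ →
    ∫ X, Ω X * fderiv ℝ φ X (F X) = -∫ X, D X * φ X

namespace VortexData

variable (P : VortexData)

/-- `K Ω = -V · ∇Ω̄` with `V = ∇^⊥ Δ⁻¹ Ω`. -/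
def K (Ω : ℂ → ℂ) (X : ℂ) : ℂ :=
  -((velocity Ω X).1 * ((fderiv ℝ P.Ωbar X 1 : ℝ) : ℂ) +
    (velocity Ω X).2 * ((fderiv ℝ P.Ωbar X Complex.I : ℝ) : ℂ))

/-- The graph of `L_b = ab + T_b + K` on `L²_n`: `Ω` is in the domain
`{Ω ∈ L²_n : div (V̄_b Ω) ∈ L²_n}` and `L_b Ω = F` almost everywhere. Since `div V̄_b = -2b`, the
transport operator is `T_b Ω = -V̄_b · ∇Ω = -(div (V̄_b Ω) + 2 b Ω)`. -/
def LbGraph (a b : ℝ) (n : ℕ) (Ω F : ℂ → ℂ) : Prop :=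
  Ω ∈ L2n n ∧ ∃ D ∈ L2n n, IsWeakDiv (P.Vb b) Ω D ∧
    ∀ᵐ X : ℂ, (a * b : ℂ) * Ω X + -(D X + 2 * (b : ℂ) * Ω X) + P.K Ω X = F X

/-- `Ker (L_b - lam)`. -/
def kerLb (a b : ℝ) (n : ℕ) (lam : ℂ) : Set (ℂ → ℂ) :=
  {W | P.LbGraph a b n W (fun X => lam * W X)}

end VortexData

/-- The Hölder class `C^γ(ℝ²)`, `γ > 0`: writing `γ = k + α` with `k ∈ ℕ` and `0 < α ≤ 1`, the
derivatives up to order `k` exist, are continuous and bounded, and those of order `k` are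
`α`-Hölder continuous. -/
def IsHolderClass (γ : ℝ) (f : ℂ → ℂ) : Prop :=
  ∃ (k : ℕ) (α : ℝ), 0 < α ∧ α ≤ 1 ∧ γ = k + α ∧ ContDiff ℝ k f ∧
    (∀ i ≤ k, ∃ C : ℝ, ∀ x, ‖iteratedFDeriv ℝ i f x‖ ≤ C) ∧
    ∃ C : ℝ, ∀ x y, ‖iteratedFDeriv ℝ k f x - iteratedFDeriv ℝ k f y‖ ≤ C * ‖x - y‖ ^ α

end

/-!
The velocity of a vorticity `g(R) e^{ikθ}` with `|k| ≥ 2` enters the equation only through its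
radial component, which is `(i sgn k / 2) φ(R) e^{ikθ}` with `φ` the radial potential of `g`.
Hence an eigenfunction of mode `k` satisfies, weakly on `(0, ∞)`, a first order equation
`(ν g)' = W̄' · v`, where `ν` is an integrating factor of the transport operator and `v` is a smooth
multiple of `φ`. As `φ` is as regular as `g`, a bootstrap makes `ν g` smooth on `(0, ∞)`.

The right-hand side vanishes where `W̄` is constant, so `ν g` is constant near the centre and far
away from it. Far away this leaves `g = C R^{lam / b - a}`, which is not square integrable unless
`C = 0`: the support is compact. Near the centre it makes `W` homogeneous of a complex degree with
real part `γ = Re lam / b - a`, and differentiating a homogeneous function lowers its degree by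
one; after `⌈γ⌉ - 1` derivatives a degree in `(0, 1]` is left, which gives Hölder continuity.
-/

section Homogeneous

universe u

variable {E G : Type*} [NormedAddCommGroup E] [NormedSpace ℝ E] [NormedAddCommGroup G]
  [NormedSpace ℝ G] [NormedSpace ℂ G]

/-- Compactly supported functions, smooth off the origin, which are positively homogeneous of the
complex degree `z` in a punctured neighbourhood of the origin, as eigenfunctions are at the centre
of the vortex. -/
structure IsHomogNearZero (z : ℂ) (F : E → G) : Prop where
  contDiffOn : ContDiffOn ℝ ∞ F {0}ᶜ
  hasCompactSupport : HasCompactSupport F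
  exists_radius : ∃ r : ℝ, 0 < r ∧ ∀ X : E, X ≠ 0 → ‖X‖ < r → ∀ t : ℝ, 0 < t → t ≤ 1 →
    F (t • X) = (t : ℂ) ^ z • F X

namespace IsHomogNearZero

variable {z : ℂ} {F : E → G}

theorem contDiffAt (h : IsHomogNearZero z F) {X : E} (hX : X ≠ 0) : ContDiffAt ℝ ∞ F X :=
  (h.contDiffOn X hX).contDiffAt (isOpen_compl_singleton.mem_nhds hX)

theorem differentiableAt (h : IsHomogNearZero z F) {X : E} (hX : X ≠ 0) :
    DifferentiableAt ℝ F X :=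
  (h.contDiffAt hX).differentiableAt (by simp)

theorem exists_norm_le_of_le_norm (h : IsHomogNearZero z F) {r : ℝ} (hr : 0 < r) :
    ∃ C : ℝ, 0 ≤ C ∧ ∀ X : E, r ≤ ‖X‖ → ‖F X‖ ≤ C * ‖X‖ ^ z.re := by
  have hne {X : E} (hX : r ≤ ‖X‖) : X ≠ 0 := norm_pos_iff.mp (hr.trans_le hX)
  have hcont : ContinuousOn (fun X => ‖F X‖ * ‖X‖ ^ (-z.re)) {0}ᶜ :=
    h.contDiffOn.continuousOn.norm.mul
      (continuous_norm.continuousOn.rpow_const fun X hX => Or.inl (norm_ne_zero_iff.mpr hX))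
  have hK : IsCompact (tsupport F ∩ {X | r ≤ ‖X‖}) :=
    h.hasCompactSupport.isCompact.inter_right (isClosed_le continuous_const continuous_norm)
  obtain ⟨M, hM⟩ := hK.bddAbove_image (hcont.mono fun X hX => hne hX.2)
  refine ⟨max M 0, le_max_right _ _, fun X hX => ?_⟩
  by_cases hXs : X ∈ tsupport F
  · have hpos : 0 < ‖X‖ := hr.trans_le hX
    have hle : ‖F X‖ * ‖X‖ ^ (-z.re) ≤ max M 0 := le_max_of_le_left (hM ⟨X, ⟨hXs, hX⟩, rfl⟩)
    rwa [Real.rpow_neg hpos.le, ← div_eq_mul_inv, div_le_iff₀ (Real.rpow_pos_of_pos hpos _)]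
      at hle
  · rw [image_eq_zero_of_notMem_tsupport hXs, norm_zero]
    positivity

theorem exists_norm_le (h : IsHomogNearZero z F) :
    ∃ C : ℝ, 0 ≤ C ∧ ∀ X : E, X ≠ 0 → ‖F X‖ ≤ C * ‖X‖ ^ z.re := by
  obtain ⟨r₀, hr₀, hhom⟩ := h.exists_radius
  obtain ⟨r, hr, hrr₀⟩ := exists_between hr₀
  obtain ⟨C, hC, hfar⟩ := h.exists_norm_le_of_le_norm hr
  refine ⟨C, hC, fun X hX => ?_⟩
  rcases le_or_gt r ‖X‖ with hXr | hXr
  · exact hfar X hXr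
  have hXpos : 0 < ‖X‖ := norm_pos_iff.mpr hX
  obtain ⟨t, ht, ht1, hXt⟩ : ∃ t : ℝ, 0 < t ∧ t ≤ 1 ∧ ‖X‖ = t * r :=
    ⟨‖X‖ / r, by positivity, (div_le_one hr).mpr hXr.le, (div_mul_cancel₀ _ hr.ne').symm⟩
  obtain ⟨Y, rfl⟩ : ∃ Y, X = t • Y := ⟨t⁻¹ • X, (smul_inv_smul₀ ht.ne' X).symm⟩
  have hY : ‖Y‖ = r := by
    rw [norm_smul, Real.norm_of_nonneg ht.le] at hXt
    exact mul_left_cancel₀ ht.ne' hXt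
  rw [hhom Y (right_ne_zero_of_smul hX) (hY.trans_lt hrr₀) t ht ht1, norm_smul, norm_smul,
    Complex.norm_cpow_eq_rpow_re_of_pos ht, Real.norm_of_nonneg ht.le,
    Real.mul_rpow ht.le (norm_nonneg _), mul_left_comm]
  gcongr
  exact hfar Y hY.ge

theorem exists_norm_le_of_map_zero (h : IsHomogNearZero z F) (h0 : F 0 = 0) :
    ∃ C : ℝ, 0 ≤ C ∧ ∀ X : E, ‖F X‖ ≤ C * ‖X‖ ^ z.re := by
  obtain ⟨C, hC, hb⟩ := h.exists_norm_le
  refine ⟨C, hC, fun X => ?_⟩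
  rcases eq_or_ne X 0 with rfl | hX
  · rw [h0, norm_zero]
    positivity
  · exact hb X hX

theorem hasFDerivAt_zero (h : IsHomogNearZero z F) (h0 : F 0 = 0) (hz : 1 < z.re) :
    HasFDerivAt F (0 : E →L[ℝ] G) 0 := by
  obtain ⟨C, -, hb⟩ := h.exists_norm_le_of_map_zero h0
  have hbig : F =O[𝓝 0] fun X : E => ‖X‖ ^ z.re :=
    .of_bound C (.of_forall fun X => by
      rw [Real.norm_of_nonneg (by positivity)]
      exact hb X)
  have hlittle : (fun X : E => ‖X‖ ^ (z.re - 1)) =o[𝓝 0] fun _ => (1 : ℝ) := by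
    rw [Asymptotics.isLittleO_one_iff]
    have hc : ContinuousAt (fun X : E => ‖X‖ ^ (z.re - 1)) 0 :=
      continuous_norm.continuousAt.rpow_const (Or.inr (by linarith))
    simpa [Real.zero_rpow (by linarith : z.re - 1 ≠ 0)] using hc.tendsto
  have hpow (X : E) : ‖X‖ ^ z.re = ‖X‖ * ‖X‖ ^ (z.re - 1) := by
    rw [← Real.rpow_one_add' (norm_nonneg X) (by linarith), add_sub_cancel]
  simp only [hpow] at hbig
  rw [hasFDerivAt_iff_isLittleO_nhds_zero]
  simp only [zero_add, h0, sub_zero, zero_apply]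
  refine hbig.trans_isLittleO (.of_norm_right ?_)
  simpa only [mul_one] using
    (Asymptotics.isBigO_refl (fun X : E => ‖X‖) (𝓝 0)).mul_isLittleO hlittle

variable [IsScalarTower ℝ ℂ G]

protected theorem fderiv (h : IsHomogNearZero z F) : IsHomogNearZero (z - 1) (fderiv ℝ F) := by
  refine ⟨h.contDiffOn.fderiv_of_isOpen isOpen_compl_singleton (by simp),
    h.hasCompactSupport.fderiv ℝ, ?_⟩
  obtain ⟨r, hr, hhom⟩ := h.exists_radius
  refine ⟨r, hr, fun X hX hXr t ht ht1 => ?_⟩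
  have hscale : (fun Y => F (t • Y)) =ᶠ[𝓝 X] fun Y => (t : ℂ) ^ z • F Y := by
    filter_upwards [isOpen_ne.mem_nhds hX,
      (isOpen_lt continuous_norm continuous_const).mem_nhds hXr]
      with Y hY hYr using hhom Y hY hYr t ht ht1
  have hd : t • fderiv ℝ F (t • X) = (t : ℂ) ^ z • fderiv ℝ F X := by
    rw [← fderiv_comp_smul, hscale.fderiv_eq, fderiv_fun_const_smul (h.differentiableAt hX)]
  have htc : (t : ℂ) ≠ 0 := Complex.ofReal_ne_zero.mpr ht.ne'
  rw [← inv_smul_smul₀ ht.ne' (fderiv ℝ F (t • X)), hd, Complex.cpow_sub _ _ htc,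
    Complex.cpow_one, div_eq_inv_mul, mul_smul, ← Complex.ofReal_inv]
  ext v
  exact (algebraMap_smul ℂ t⁻¹ _).symm

theorem exists_norm_sub_le_of_norm_le (h : IsHomogNearZero z F) (h0 : F 0 = 0)
    (hz0 : 0 < z.re) (hz1 : z.re ≤ 1) :
    ∃ C : ℝ, ∀ x y, ‖y‖ ≤ ‖x‖ → ‖F x - F y‖ ≤ C * ‖x - y‖ ^ z.re := by
  obtain ⟨C, hC, hb⟩ := h.exists_norm_le_of_map_zero h0
  obtain ⟨D, hD, hd⟩ := h.fderiv.exists_norm_le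
  refine ⟨C * 2 ^ z.re + C * 2 ^ z.re + D, fun x y hyx => ?_⟩
  have hp : 0 ≤ ‖x - y‖ ^ z.re := by positivity
  rcases le_or_gt ‖x‖ (2 * ‖x - y‖) with hnear | hfar
  · have hx : ‖x‖ ^ z.re ≤ 2 ^ z.re * ‖x - y‖ ^ z.re := by
      rw [← Real.mul_rpow zero_le_two (norm_nonneg _)]
      exact Real.rpow_le_rpow (norm_nonneg _) hnear hz0.le
    have hy : ‖y‖ ^ z.re ≤ 2 ^ z.re * ‖x - y‖ ^ z.re :=
      (Real.rpow_le_rpow (norm_nonneg _) hyx hz0.le).trans hx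
    calc ‖F x - F y‖ ≤ C * ‖x‖ ^ z.re + C * ‖y‖ ^ z.re :=
          (norm_sub_le _ _).trans (add_le_add (hb x) (hb y))
      _ ≤ C * (2 ^ z.re * ‖x - y‖ ^ z.re) + C * (2 ^ z.re * ‖x - y‖ ^ z.re) := by gcongr
      _ ≤ (C * 2 ^ z.re + C * 2 ^ z.re + D) * ‖x - y‖ ^ z.re := by
          nlinarith [mul_nonneg hD hp]
  rcases eq_or_ne x y with rfl | hxy
  · rw [sub_self, norm_zero]
    positivity
  have hxy' : 0 < ‖x - y‖ := norm_sub_pos_iff.mpr hxy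
  have hball : ∀ u ∈ Metric.closedBall x ‖x - y‖, ‖x - y‖ ≤ ‖u‖ := fun u hu => by
    rw [mem_closedBall_iff_norm'] at hu
    linarith [norm_le_norm_add_norm_sub u x, norm_sub_rev u x]
  have hball0 : ∀ u ∈ Metric.closedBall x ‖x - y‖, u ≠ 0 := fun u hu =>
    norm_pos_iff.mp (hxy'.trans_le (hball u hu))
  have hderiv : ∀ u ∈ Metric.closedBall x ‖x - y‖, ‖fderiv ℝ F u‖ ≤ D * ‖x - y‖ ^ (z.re - 1) :=
    fun u hu => (hd u (hball0 u hu)).trans (mul_le_mul_of_nonneg_left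
      (Real.rpow_le_rpow_of_nonpos hxy' (hball u hu) (by simpa using hz1)) hD)
  calc ‖F x - F y‖ ≤ D * ‖x - y‖ ^ (z.re - 1) * ‖x - y‖ :=
        (convex_closedBall x ‖x - y‖).norm_image_sub_le_of_norm_fderiv_le
          (fun u hu => h.differentiableAt (hball0 u hu)) hderiv
          (mem_closedBall_iff_norm'.mpr le_rfl) (Metric.mem_closedBall_self (norm_nonneg _))
    _ = D * ‖x - y‖ ^ z.re := by rw [mul_assoc, ← Real.rpow_add_one hxy'.ne', sub_add_cancel]
    _ ≤ (C * 2 ^ z.re + C * 2 ^ z.re + D) * ‖x - y‖ ^ z.re := by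
        gcongr
        linarith [show 0 ≤ C * 2 ^ z.re by positivity]

theorem exists_holder (h : IsHomogNearZero z F) (h0 : F 0 = 0) (hz0 : 0 < z.re)
    (hz1 : z.re ≤ 1) : ∃ C : ℝ, ∀ x y, ‖F x - F y‖ ≤ C * ‖x - y‖ ^ z.re := by
  obtain ⟨C, hC⟩ := h.exists_norm_sub_le_of_norm_le h0 hz0 hz1
  refine ⟨C, fun x y => ?_⟩
  rcases le_total ‖y‖ ‖x‖ with hyx | hxy
  · exact hC x y hyx
  · rw [norm_sub_rev, norm_sub_rev x y]
    exact hC y x hxy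

end IsHomogNearZero

theorem continuous_of_norm_sub_le_rpow {E G : Type*} [SeminormedAddCommGroup E]
    [SeminormedAddCommGroup G] {F : E → G} {C α : ℝ} (hα : 0 < α)
    (hF : ∀ x y, ‖F x - F y‖ ≤ C * ‖x - y‖ ^ α) : Continuous F := by
  refine continuous_iff_continuousAt.mpr fun x => tendsto_iff_norm_sub_tendsto_zero.mpr ?_
  have hc : ContinuousAt (fun y => C * ‖y - x‖ ^ α) x :=
    continuousAt_const.mul (ContinuousAt.rpow_const (by fun_prop) (Or.inr hα.le))
  refine squeeze_zero (fun _ => norm_nonneg _) (fun y => hF y x) ?_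
  simpa [Real.zero_rpow hα.ne'] using hc.tendsto

theorem norm_iteratedFDeriv_succ_sub {E G : Type*} [NormedAddCommGroup E] [NormedSpace ℝ E]
    [NormedAddCommGroup G] [NormedSpace ℝ G] (F : E → G) (K : ℕ) (x y : E) :
    ‖iteratedFDeriv ℝ (K + 1) F x - iteratedFDeriv ℝ (K + 1) F y‖ =
      ‖iteratedFDeriv ℝ K (fderiv ℝ F) x - iteratedFDeriv ℝ K (fderiv ℝ F) y‖ := by
  simp only [iteratedFDeriv_succ_eq_comp_right, Function.comp_apply, ← dist_eq_norm]
  exact LinearIsometryEquiv.dist_map _ _ _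

theorem IsHomogNearZero.contDiff_and_holder {E : Type u} [NormedAddCommGroup E] [NormedSpace ℝ E]
    (K : ℕ) {α : ℝ} (hα : 0 < α) (hα1 : α ≤ 1) : ∀ {G : Type u} [NormedAddCommGroup G]
    [NormedSpace ℝ G] [NormedSpace ℂ G] [IsScalarTower ℝ ℂ G] {z : ℂ} {F : E → G},
    IsHomogNearZero z F → F 0 = 0 → z.re = K + α → ContDiff ℝ K F ∧ ∃ C : ℝ, ∀ x y,
      ‖iteratedFDeriv ℝ K F x - iteratedFDeriv ℝ K F y‖ ≤ C * ‖x - y‖ ^ α := by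
  induction K with
  | zero =>
    intro G _ _ _ _ z F h h0 hz
    obtain rfl : z.re = α := by simpa using hz
    obtain ⟨C, hC⟩ := h.exists_holder h0 hα hα1
    refine ⟨contDiff_zero.mpr (continuous_of_norm_sub_le_rpow hα hC), C, fun x y => ?_⟩
    simpa only [iteratedFDeriv_zero_eq_comp, Function.comp_apply, ← map_sub,
      LinearIsometryEquiv.norm_map] using hC x y
  | succ K ih =>
    intro G _ _ _ _ z F h h0 hz
    push_cast at hz
    have hF0 := h.hasFDerivAt_zero h0 (by linarith [(Nat.cast_nonneg K : (0 : ℝ) ≤ K)])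
    obtain ⟨hsmooth, C, hC⟩ := ih h.fderiv hF0.fderiv
      (by rw [Complex.sub_re, Complex.one_re]; linarith)
    refine ⟨?_, C, fun x y => (norm_iteratedFDeriv_succ_sub F K x y).trans_le (hC x y)⟩
    rw [Nat.cast_succ, contDiff_succ_iff_fderiv]
    refine ⟨fun x => ?_, by simp, hsmooth⟩
    rcases eq_or_ne x 0 with rfl | hx
    exacts [hF0.differentiableAt, h.differentiableAt hx]

theorem IsHomogNearZero.isHolderClass {z : ℂ} {F : ℂ → ℂ} (h : IsHomogNearZero z F)
    (h0 : F 0 = 0) (hz : 0 < z.re) : IsHolderClass z.re F := by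
  obtain ⟨k, hk⟩ : ∃ k : ℕ, ⌈z.re⌉₊ = k + 1 :=
    Nat.exists_eq_succ_of_ne_zero (Nat.ceil_pos.mpr hz).ne'
  have hle : z.re ≤ k + 1 := by exact_mod_cast hk ▸ Nat.le_ceil z.re
  have hlt : (k : ℝ) < z.re := Nat.lt_ceil.mp (by lia)
  obtain ⟨hsmooth, hholder⟩ := h.contDiff_and_holder k (α := z.re - k) (by linarith)
    (by linarith) h0 (by ring)
  refine ⟨k, z.re - k, by linarith, by linarith, by ring, hsmooth, fun i hi => ?_, hholder⟩
  exact (h.hasCompactSupport.iteratedFDeriv i).exists_bound_of_continuous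
    (hsmooth.continuous_iteratedFDeriv (by exact_mod_cast hi))

end Homogeneous

section RadialFunctions

variable {E F : Type*} [NormedAddCommGroup E] [NormedAddCommGroup F] [NormedSpace ℝ F]

theorem integral_comp_norm (f : ℝ → F) :
    ∫ X : ℂ, f ‖X‖ = (2 * Real.pi) • ∫ s in Set.Ioi (0 : ℝ), s • f s := by
  rw [integral_fun_norm_addHaar, ← Nat.cast_smul_eq_nsmul ℝ]
  simp [Measure.real, smul_smul]

theorem integrable_comp_norm_iff {f : ℝ → F} :
    Integrable (fun X : ℂ => f ‖X‖) ↔ IntegrableOn (fun s : ℝ => s • f s) (Set.Ioi 0) := by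
  simp [integrable_fun_norm_addHaar]

theorem integrableOn_ball_comp_norm_iff {f : ℝ → F} {r : ℝ} :
    IntegrableOn (fun X : ℂ => f ‖X‖) (Metric.ball 0 r) ↔
      IntegrableOn (fun s : ℝ => s • f s) (Set.Ioo 0 r) := by
  simp [integrableOn_fun_norm_addHaar]

theorem ae_eq_comp_norm {u v : ℝ → E} (h : u =ᵐ[volume.restrict (Set.Ioi 0)] v) :
    (fun X : ℂ => u ‖X‖) =ᵐ[volume] fun X => v ‖X‖ := by
  have hzero : (fun s : ℝ => s • ‖u s - v s‖) =ᵐ[volume.restrict (Set.Ioi 0)] 0 := by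
    filter_upwards [h] with s hs
    simp [hs]
  have hint : Integrable (fun X : ℂ => ‖u ‖X‖ - v ‖X‖‖) :=
    integrable_comp_norm_iff (f := fun s => ‖u s - v s‖).2
      ((integrable_zero _ _ _).congr hzero.symm)
  have hnull : ∫ X : ℂ, ‖u ‖X‖ - v ‖X‖‖ = 0 := by
    rw [integral_comp_norm (fun s => ‖u s - v s‖), integral_eq_zero_of_ae hzero, smul_zero]
  filter_upwards [(integral_eq_zero_iff_of_nonneg (fun _ => norm_nonneg _) hint).1 hnull]
    with X hX using sub_eq_zero.1 (norm_eq_zero.1 hX)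

theorem aestronglyMeasurable_of_locallyIntegrable_comp_norm {f : ℝ → F}
    (hf : LocallyIntegrable (fun X : ℂ => f ‖X‖)) :
    AEStronglyMeasurable f (volume.restrict (Set.Ioi 0)) := by
  have hU : Set.Ioi (0 : ℝ) = ⋃ N : ℕ, Set.Ioo (0 : ℝ) N := by
    ext x
    simpa using fun _ => exists_nat_gt x
  rw [hU, aestronglyMeasurable_iUnion_iff]
  intro N
  have hball : IntegrableOn (fun X : ℂ => f ‖X‖) (Metric.ball 0 (N : ℝ)) :=
    (hf.integrableOn_isCompact (isCompact_closedBall 0 (N : ℝ))).mono_set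
      Metric.ball_subset_closedBall
  have hmul : AEStronglyMeasurable (fun s : ℝ => s⁻¹ • (s • f s))
      (volume.restrict (Set.Ioo (0 : ℝ) N)) :=
    .fun_smul (by fun_prop) (integrableOn_ball_comp_norm_iff.1 hball).1
  refine hmul.congr ?_
  filter_upwards [ae_restrict_mem measurableSet_Ioo] with s hs using inv_smul_smul₀ hs.1.ne' _

end RadialFunctions

section Modes

/-- The function `f(R) e^{ikθ}` of mode `k` with radial profile `f`. -/
noncomputable def modeFun (f : ℝ → ℂ) (k : ℤ) (X : ℂ) : ℂ := f ‖X‖ * (X / (‖X‖ : ℂ)) ^ k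

/-- The radial profiles of square integrable functions on the plane. -/
structure RadialL2 (g : ℝ → ℂ) : Prop where
  aestronglyMeasurable : AEStronglyMeasurable g (volume.restrict (Set.Ioi 0))
  integrableOn_sq : IntegrableOn (fun s : ℝ => s * ‖g s‖ ^ 2) (Set.Ioi 0)

variable {W : ℂ → ℂ} {g : ℝ → ℂ} {k : ℤ} {X : ℂ}

theorem norm_unit_zpow (hX : X ≠ 0) (k : ℤ) : ‖(X / (‖X‖ : ℂ)) ^ k‖ = 1 := by
  rw [norm_zpow, norm_div, Complex.norm_real, norm_norm, div_self (norm_ne_zero_iff.2 hX),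
    one_zpow]

theorem unit_zpow_ne_zero (hX : X ≠ 0) (k : ℤ) : (X / (‖X‖ : ℂ)) ^ k ≠ 0 :=
  norm_ne_zero_iff.1 ((norm_unit_zpow hX k).trans_ne one_ne_zero)

theorem contDiffAt_unit_zpow (k : ℤ) (hX : X ≠ 0) :
    ContDiffAt ℝ ∞ (fun Y : ℂ => (Y / (‖Y‖ : ℂ)) ^ k) X := by
  have hXn : (‖X‖ : ℂ) ≠ 0 := Complex.ofReal_ne_zero.2 (norm_ne_zero_iff.2 hX)
  have hnorm : ContDiffAt ℝ ∞ (fun Y : ℂ => (‖Y‖ : ℂ)) X :=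
    Complex.ofRealCLM.contDiff.contDiffAt.comp X (contDiffAt_norm ℝ hX)
  have hunit : ContDiffAt ℝ ∞ (fun Y : ℂ => Y / (‖Y‖ : ℂ)) X := by
    simp only [div_eq_mul_inv]
    exact contDiffAt_id.mul (hnorm.inv hXn)
  have hzpow : ContDiffAt ℝ ∞ (fun Z : ℂ => Z ^ k) (X / ‖X‖) :=
    ((analyticAt_id (𝕜 := ℂ)).fun_zpow (div_ne_zero hX hXn)).contDiffAt.restrict_scalars ℝ
  exact hzpow.comp X hunit

theorem conj_modeFun (g : ℝ → ℂ) (k : ℤ) (hX : X ≠ 0) :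
    (starRingEnd ℂ) (modeFun g k X) = modeFun (fun s => (starRingEnd ℂ) (g s)) (-k) X := by
  have hXn : (‖X‖ : ℂ) ≠ 0 := Complex.ofReal_ne_zero.2 (norm_ne_zero_iff.2 hX)
  have hunit : (starRingEnd ℂ) (X / (‖X‖ : ℂ)) = (X / (‖X‖ : ℂ))⁻¹ := by
    rw [map_div₀, Complex.conj_ofReal, inv_div, div_eq_div_iff hXn hX, Complex.conj_mul', sq]
  rw [modeFun, modeFun, map_mul, map_zpow₀, hunit, inv_zpow, zpow_neg]

theorem memLp_comp_norm_of_ae_eq_modeFun (hL : MemLp W 2 volume) (hW : W =ᵐ[volume] modeFun g k) :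
    MemLp (fun X : ℂ => g ‖X‖) 2 volume := by
  have hmeas : AEStronglyMeasurable (fun X : ℂ => (X / (‖X‖ : ℂ)) ^ (-k)) volume := by
    rw [← restrict_compl_singleton (μ := (volume : Measure ℂ)) 0]
    exact ContinuousOn.aestronglyMeasurable
      (fun X hX => (contDiffAt_unit_zpow _ hX).continuousAt.continuousWithinAt)
      (measurableSet_singleton _).compl
  have hg : (fun X => (X / (‖X‖ : ℂ)) ^ (-k) * W X) =ᵐ[volume] fun X : ℂ => g ‖X‖ := by
    filter_upwards [hW, volume.ae_ne 0] with X hX hX0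
    rw [hX, modeFun, zpow_neg, mul_comm (g ‖X‖), inv_mul_cancel_left₀ (unit_zpow_ne_zero hX0 k)]
  refine (hL.of_le (hmeas.mul hL.1) ?_).ae_eq hg
  filter_upwards [volume.ae_ne 0] with X hX0
  rw [Pi.mul_apply, norm_mul, norm_unit_zpow hX0, one_mul]

theorem RadialL2.of_memLp (hL : MemLp W 2 volume) (hW : W =ᵐ[volume] modeFun g k) :
    RadialL2 g := by
  have hg := memLp_comp_norm_of_ae_eq_modeFun hL hW
  refine ⟨aestronglyMeasurable_of_locallyIntegrable_comp_norm
    (hg.locallyIntegrable one_le_two), ?_⟩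
  simpa using (integrable_comp_norm_iff (f := fun s => ‖g s‖ ^ 2)).1 hg.norm.integrable_sq

namespace RadialL2

theorem conj (h : RadialL2 g) : RadialL2 fun s => (starRingEnd ℂ) (g s) :=
  ⟨Complex.continuous_conj.comp_aestronglyMeasurable h.aestronglyMeasurable, by
    simpa only [RCLike.norm_conj] using h.integrableOn_sq⟩

theorem integrableOn_mul (h : RadialL2 g) {q : ℝ → ℝ} {S : Set ℝ} (hS : MeasurableSet S)
    (hS0 : S ⊆ Set.Ioi 0) (hqm : Measurable q) (hq : IntegrableOn (fun s => s⁻¹ * q s ^ 2) S) :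
    IntegrableOn (fun s => (q s : ℂ) * g s) S := by
  refine ((h.integrableOn_sq.mono_set hS0).add hq).mono' ?_ ?_
  · exact (Complex.measurable_ofReal.comp hqm).aestronglyMeasurable.fun_mul
      (h.aestronglyMeasurable.mono_set hS0)
  · filter_upwards [ae_restrict_mem hS] with s hs
    have hs0 : 0 < s := hS0 hs
    have hamgm : 0 ≤ s * (‖g s‖ - s⁻¹ * |q s|) ^ 2 := by positivity
    have hexpand : s * (‖g s‖ - s⁻¹ * |q s|) ^ 2 =
        s * ‖g s‖ ^ 2 + s⁻¹ * q s ^ 2 - 2 * (|q s| * ‖g s‖) := by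
      rw [← sq_abs (q s)]
      field_simp
      ring
    rw [norm_mul, Complex.norm_real, Real.norm_eq_abs, Pi.add_apply]
    linarith [show 0 ≤ |q s| * ‖g s‖ by positivity]

theorem integrableOn_inner (h : RadialL2 g) (m : ℕ) (R : ℝ) :
    IntegrableOn (fun s : ℝ => (s : ℂ) ^ (m + 1) * g s) (Set.Ioc 0 R) := by
  have hq : IntegrableOn (fun s : ℝ => s⁻¹ * (s ^ (m + 1)) ^ 2) (Set.Ioc 0 R) := by
    refine (by fun_prop : Continuous fun s : ℝ => s ^ (2 * m + 1)).integrableOn_Ioc.congr_fun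
      (fun s hs => ?_) measurableSet_Ioc
    have hs0 : s ≠ 0 := hs.1.ne'
    field_simp
    ring
  simpa using h.integrableOn_mul measurableSet_Ioc (fun s hs => hs.1) (by fun_prop) hq

theorem integrableOn_outer (h : RadialL2 g) {m : ℕ} (hm : 2 ≤ m) {R : ℝ} (hR : 0 < R) :
    IntegrableOn (fun s : ℝ => (s : ℂ) * ((s : ℂ) ^ m)⁻¹ * g s) (Set.Ioi R) := by
  have hm' : (2 : ℝ) ≤ m := by exact_mod_cast hm
  have hq : IntegrableOn (fun s : ℝ => s⁻¹ * (s * (s ^ m)⁻¹) ^ 2) (Set.Ioi R) := by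
    refine (integrableOn_Ioi_rpow_of_lt (a := 1 - m * 2) (by linarith) hR).congr_fun
      (fun s hs => ?_) measurableSet_Ioi
    have hs0 : 0 < s := hR.trans hs
    simp only [Real.rpow_sub hs0, Real.rpow_one, Real.rpow_mul hs0.le, Real.rpow_natCast,
      Real.rpow_ofNat]
    field_simp
  simpa using h.integrableOn_mul measurableSet_Ioi (fun s hs => hR.trans hs) (by fun_prop) hq

end RadialL2

end Modes

section CauchyKernel

theorem circleAverage_div_sub_mul_pow {w : ℂ} (hw : ‖w‖ < 1) (m : ℕ) :
    Real.circleAverage (fun e : ℂ => e / (e - w) * e ^ m) 0 1 = w ^ m := by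
  simpa using DiffContOnCl.circleAverage_smul_div (f := fun e : ℂ => e ^ m) (c := 0) (R := 1)
    (w := w) (by fun_prop : Differentiable ℂ fun e : ℂ => e ^ m).diffContOnCl (by simpa using hw)

theorem circleAverage_div_sub_mul_pow_of_one_lt_norm {w : ℂ} (hw : 1 < ‖w‖) (m : ℕ) :
    Real.circleAverage (fun e : ℂ => e / (e - w) * e ^ m) 0 1 = 0 := by
  have hdiff : DifferentiableOn ℂ (fun e : ℂ => e / (e - w) * e ^ m) (Metric.closedBall 0 |1|) := by
    refine fun e he => DifferentiableAt.differentiableWithinAt ?_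
    have hew : e - w ≠ 0 := by
      rintro h
      rw [sub_eq_zero.1 h, abs_one, mem_closedBall_zero_iff] at he
      exact hw.not_ge he
    fun_prop (disch := exact hew)
  simpa using DiffContOnCl.circleAverage (hdiff.diffContOnCl_ball subset_rfl)

/-- The angular average of the Cauchy kernel against `e^{ikθ}`: for `w = X / s`, the mean of
`X / (X - Y) * (Y / |Y|) ^ k` over the circle `|Y| = s`. -/
noncomputable def cauchyMode (k : ℤ) (w : ℂ) : ℂ :=
  Real.circleAverage (fun e => w / (w - e) * e ^ k) 0 1

theorem cauchyMode_natCast_succ (m : ℕ) (w : ℂ) : cauchyMode (m + 1 : ℕ) w =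
    -w * Real.circleAverage (fun e : ℂ => e / (e - w) * e ^ m) 0 1 := by
  rw [cauchyMode, ← smul_eq_mul, ← Real.circleAverage_fun_smul]
  congr 1
  ext e
  rw [zpow_natCast, pow_succ, ← neg_sub e w, div_neg, smul_eq_mul]
  ring

theorem cauchyMode_neg_natCast (m : ℕ) {w : ℂ} (hw : w ≠ 0) : cauchyMode (-(m : ℤ)) w =
    Real.circleAverage (fun e : ℂ => e / (e - w⁻¹) * e ^ m) 0 1 := by
  rw [cauchyMode, ← Real.circleAverage_zero_one_congr_inv]
  refine Real.circleAverage_congr_sphere fun e he => ?_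
  have he0 : e ≠ 0 := ne_zero_of_mem_sphere (by simp) ⟨e, he⟩
  have hkernel : w / (w - e⁻¹) = e / (e - w⁻¹) := by
    rw [← mul_div_mul_right _ _ he0, ← mul_div_mul_left e _ hw, sub_mul, mul_sub,
      inv_mul_cancel₀ he0, mul_inv_cancel₀ hw]
  simp only [hkernel, zpow_neg, zpow_natCast, inv_pow, inv_inv]

variable {E : Type*} [NormedAddCommGroup E] [NormedSpace ℝ E]
  {W : ℂ → ℂ} {g : ℝ → ℂ} {k : ℤ} {X : ℂ}

theorem complexPolarCoord_symm_eq_circleMap (p : ℝ × ℝ) :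
    Complex.polarCoord.symm p = circleMap 0 p.1 p.2 := by
  rw [Complex.polarCoord_symm_apply, circleMap_zero, Complex.exp_mul_I, Complex.ofReal_cos,
    Complex.ofReal_sin]

theorem integrableOn_comp_polarCoord_symm {f : ℂ → E} (hf : Integrable f) :
    IntegrableOn (fun p : ℝ × ℝ => p.1 • f (Complex.polarCoord.symm p)) polarCoord.target := by
  have hprod : Integrable (fun p : ℝ × ℝ => f (Complex.measurableEquivRealProd.symm p)) :=
    Complex.volume_preserving_equiv_real_prod.symm.integrable_comp_of_integrable hf
  have hpolar := (integrableOn_image_iff_integrableOn_abs_det_fderiv_smul volume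
    polarCoord.open_target.measurableSet
    (fun p _ => (hasFDerivAt_polarCoord_symm p).hasFDerivWithinAt)
    polarCoord.symm.injOn _).1 hprod.integrableOn
  refine hpolar.congr_fun (fun p hp => ?_) polarCoord.open_target.measurableSet
  simp only [det_fderivPolarCoordSymm, abs_of_pos (Set.mem_Ioi.1 hp.1),
    Complex.measurableEquivRealProd_symm_polarCoord_symm_apply]

theorem integral_Ioo_circleMap (f : ℂ → E) (s : ℝ) :
    ∫ φ in Set.Ioo (-Real.pi) Real.pi, f (circleMap 0 s φ) =
      (2 * Real.pi) • Real.circleAverage f 0 s := by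
  rw [Real.circleAverage_eq_integral_add (-Real.pi), smul_inv_smul₀ Real.two_pi_pos.ne',
    intervalIntegral.integral_comp_add_right (fun φ => f (circleMap 0 s φ)),
    intervalIntegral.integral_of_le (by linarith [Real.pi_pos]), integral_Ioc_eq_integral_Ioo]
  ring_nf

theorem integral_eq_integral_circleAverage {f : ℂ → E} (hf : Integrable f) :
    ∫ X, f X = (2 * Real.pi) • ∫ s in Set.Ioi (0 : ℝ), s • Real.circleAverage f 0 s := by
  have hpolar := integrableOn_comp_polarCoord_symm hf
  rw [IntegrableOn, polarCoord_target, Measure.volume_eq_prod, ← Measure.prod_restrict] at hpolar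
  rw [← Complex.integral_comp_polarCoord_symm, polarCoord_target, Measure.volume_eq_prod,
    ← Measure.prod_restrict, integral_prod _ hpolar, ← integral_smul]
  refine integral_congr_ae (.of_forall fun s => ?_)
  simp only [complexPolarCoord_symm_eq_circleMap, integral_smul, integral_Ioo_circleMap]
  exact smul_comm _ _ _

theorem circleAverage_cauchy_modeFun (g : ℝ → ℂ) (k : ℤ) (X : ℂ) {s : ℝ} (hs : 0 < s) :
    Real.circleAverage (fun Y => X / (X - Y) * modeFun g k Y) 0 s =
      g s * cauchyMode k (X / s) := by
  have hs0 : (s : ℂ) ≠ 0 := Complex.ofReal_ne_zero.2 hs.ne'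
  rw [Real.circleAverage_eq_circleAverage_zero_one, cauchyMode, ← smul_eq_mul (g s),
    ← Real.circleAverage_fun_smul]
  refine Real.circleAverage_congr_sphere fun e he => ?_
  have he1 : ‖e‖ = 1 := by simpa using he
  have hkernel : X / (X - s * e) = X / s / (X / s - e) := by
    rw [← mul_div_mul_left (X / s) _ hs0, mul_sub, mul_div_cancel₀ X hs0]
  simp only [add_zero, modeFun, norm_mul, Complex.norm_real, Real.norm_of_nonneg hs.le, he1,
    mul_one, mul_div_cancel_left₀ e hs0, hkernel, smul_eq_mul]
  ring

theorem mul_setIntegral_cauchy (hW : W =ᵐ[volume] modeFun g k) {ρ : ℝ}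
    (hX : IntegrableOn (fun Y => (X - Y)⁻¹ * W Y) (Metric.ball 0 ρ)) :
    X * ∫ Y in Metric.ball 0 ρ, (X - Y)⁻¹ * W Y =
      2 * Real.pi * ∫ s in Set.Ioo 0 ρ, s * (g s * cauchyMode k (X / s)) := by
  set h : ℂ → ℂ := fun Y => X / (X - Y) * modeFun g k Y
  have hWh : (fun Y => X * ((X - Y)⁻¹ * W Y)) =ᵐ[volume] h := by
    filter_upwards [hW] with Y hY
    rw [hY, ← mul_assoc, ← div_eq_mul_inv]
  have hh : Integrable ((Metric.ball 0 ρ).indicator h) :=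
    (integrable_indicator_iff measurableSet_ball).2
      ((hX.const_mul X).congr (ae_restrict_of_ae hWh))
  have hcircle : ∀ s ∈ Set.Ioi (0 : ℝ),
      s • Real.circleAverage ((Metric.ball 0 ρ).indicator h) 0 s =
        (Set.Iio ρ).indicator (fun s : ℝ => s * (g s * cauchyMode k (X / s))) s := by
    intro s hs
    have hball : ∀ Y ∈ Metric.sphere (0 : ℂ) |s|, Y ∈ Metric.ball (0 : ℂ) ρ ↔ s < ρ := by
      intro Y hY
      rw [mem_ball_zero_iff, mem_sphere_zero_iff_norm.1 hY, abs_of_pos hs]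
    by_cases hsρ : s < ρ
    · rw [Set.indicator_of_mem (Set.mem_Iio.2 hsρ), ← circleAverage_cauchy_modeFun g k X hs,
        Complex.real_smul, Real.circleAverage_congr_sphere fun Y hY =>
          Set.indicator_of_mem ((hball Y hY).2 hsρ) h]
    · rw [Set.indicator_of_notMem (Set.notMem_Iio.2 (not_lt.1 hsρ)),
        Real.circleAverage_const_on_circle fun Y hY =>
          Set.indicator_of_notMem (mt (hball Y hY).1 hsρ) h, smul_zero]
  rw [← integral_const_mul, integral_congr_ae (ae_restrict_of_ae hWh),
    ← integral_indicator measurableSet_ball, integral_eq_integral_circleAverage hh,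
    setIntegral_congr_fun measurableSet_Ioi hcircle, setIntegral_indicator measurableSet_Iio,
    Set.Ioi_inter_Iio, Complex.real_smul]
  push_cast
  rfl

theorem integrableOn_ball_inv (ρ : ℝ) : IntegrableOn (fun Z : ℂ => Z⁻¹) (Metric.ball 0 ρ) := by
  have hrad : IntegrableOn (fun s : ℝ => s • s⁻¹) (Set.Ioo 0 ρ) :=
    (integrableOn_const (C := (1 : ℝ)) (by simp)).congr_fun
      (fun s hs => (mul_inv_cancel₀ hs.1.ne').symm) measurableSet_Ioo
  refine (integrableOn_ball_comp_norm_iff.2 hrad).mono' (by fun_prop) (.of_forall fun X => ?_)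
  rw [norm_inv]

theorem ae_integrableOn_cauchy (hW : LocallyIntegrable W) :
    ∀ᵐ X : ℂ, ∀ ρ : ℝ, IntegrableOn (fun Y => (X - Y)⁻¹ * W Y) (Metric.ball 0 ρ) := by
  have hball : ∀ N : ℕ, ∀ᵐ X : ℂ, X ∈ Metric.ball (0 : ℂ) N →
      IntegrableOn (fun Y => (X - Y)⁻¹ * W Y) (Metric.ball 0 (N : ℝ)) := by
    intro N
    have hf : Integrable ((Metric.ball (0 : ℂ) N).indicator W) :=
      (integrable_indicator_iff measurableSet_ball).2
        ((hW.integrableOn_isCompact (isCompact_closedBall 0 (N : ℝ))).mono_set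
          Metric.ball_subset_closedBall)
    have hinv : Integrable ((Metric.ball (0 : ℂ) (2 * N)).indicator fun Z : ℂ => Z⁻¹) :=
      (integrable_indicator_iff measurableSet_ball).2 (integrableOn_ball_inv _)
    filter_upwards [Integrable.ae_convolution_exists (ContinuousLinearMap.mul ℝ ℂ) hf hinv]
      with X hX hXN
    refine IntegrableOn.congr_fun (Integrable.integrableOn hX) (fun Y hY => ?_) measurableSet_ball
    have hXY : X - Y ∈ Metric.ball (0 : ℂ) (2 * N) := by
      rw [mem_ball_zero_iff] at hY hXN ⊢
      linarith [norm_sub_le X Y]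
    rw [ContinuousLinearMap.mul_apply', Set.indicator_of_mem hY, Set.indicator_of_mem hXY, mul_comm]
  filter_upwards [ae_all_iff.2 hball] with X hX ρ
  obtain ⟨N, hN⟩ := exists_nat_gt (max ρ ‖X‖)
  refine (hX N ?_).mono_set (Metric.ball_subset_ball ((le_max_left _ _).trans hN.le))
  exact mem_ball_zero_iff.2 ((le_max_right _ _).trans_lt hN)

end CauchyKernel

section BiotSavart

variable {W : ℂ → ℂ} {g : ℝ → ℂ} {k : ℤ} {X : ℂ}

/-- The part of the radial potential `radialPot m g R` generated by the vorticity in `|Y| < R`. -/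
noncomputable def innerPot (m : ℕ) (g : ℝ → ℂ) (R : ℝ) : ℂ :=
  ∫ s in Set.Ioc 0 R, (s : ℂ) ^ (m + 1) * g s

/-- The part of the radial potential `radialPot m g R` generated by the vorticity in `|Y| > R`. -/
noncomputable def outerPot (m : ℕ) (g : ℝ → ℂ) (R : ℝ) : ℂ :=
  ∫ s in Set.Ioi R, (s : ℂ) * ((s : ℂ) ^ m)⁻¹ * g s

/-- The radial potential: up to the factor `-1 / (2 m)`, the profile of the stream function of the
vorticity `g(R) e^{± imθ}`. -/
noncomputable def radialPot (m : ℕ) (g : ℝ → ℂ) (R : ℝ) : ℂ :=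
  ((R : ℂ) ^ m)⁻¹ * innerPot m g R + (R : ℂ) ^ m * outerPot m g R

theorem conj_innerPot_conj (m : ℕ) (g : ℝ → ℂ) (R : ℝ) :
    (starRingEnd ℂ) (innerPot m (fun s => (starRingEnd ℂ) (g s)) R) = innerPot m g R := by
  simp [innerPot, ← integral_conj]

theorem conj_outerPot_conj (m : ℕ) (g : ℝ → ℂ) (R : ℝ) :
    (starRingEnd ℂ) (outerPot m (fun s => (starRingEnd ℂ) (g s)) R) = outerPot m g R := by
  simp [outerPot, ← integral_conj]

theorem tendsto_mul_setIntegral_cauchy (hW : W =ᵐ[volume] modeFun g k)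
    (hX : ∀ ρ : ℝ, IntegrableOn (fun Y => (X - Y)⁻¹ * W Y) (Metric.ball 0 ρ)) {S : Set ℝ}
    (hS : MeasurableSet S) (hS0 : S ⊆ Set.Ioi 0) {F : ℝ → ℂ} (hF : IntegrableOn F S)
    (hmem : ∀ s ∈ S, s ≠ ‖X‖ → s * (g s * cauchyMode k (X / s)) = F s)
    (hnotMem : ∀ s ∉ S, 0 < s → s ≠ ‖X‖ → cauchyMode k (X / s) = 0) :
    Tendsto (fun ρ : ℝ => X * ∫ Y in Metric.ball 0 ρ, (X - Y)⁻¹ * W Y) atTop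
      (𝓝 (2 * Real.pi * ∫ s in S, F s)) := by
  rw [← Set.inter_eq_right.2 hS0, ← setIntegral_indicator hS]
  have hF' : IntegrableOn (S.indicator F) (Set.Ioi 0) :=
    ((integrable_indicator_iff hS).2 hF).integrableOn
  refine ((intervalIntegral_tendsto_integral_Ioi 0 hF' tendsto_id).const_mul _).congr' ?_
  filter_upwards [eventually_ge_atTop 0] with ρ hρ
  rw [id, intervalIntegral.integral_of_le hρ, integral_Ioc_eq_integral_Ioo,
    mul_setIntegral_cauchy hW (hX ρ)]
  congr 1
  refine setIntegral_congr_ae measurableSet_Ioo ?_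
  filter_upwards [volume.ae_ne ‖X‖] with s hs hs0
  by_cases hsS : s ∈ S
  · rw [Set.indicator_of_mem hsS, hmem s hsS hs]
  · rw [Set.indicator_of_notMem hsS, hnotMem s hsS hs0.1 hs, mul_zero, mul_zero]

theorem tendsto_mul_setIntegral_cauchy_natCast {m : ℕ} (hm : 2 ≤ m) (hg : RadialL2 g)
    (hW : W =ᵐ[volume] modeFun g m) (hX0 : X ≠ 0)
    (hX : ∀ ρ : ℝ, IntegrableOn (fun Y => (X - Y)⁻¹ * W Y) (Metric.ball 0 ρ)) :
    Tendsto (fun ρ : ℝ => X * ∫ Y in Metric.ball 0 ρ, (X - Y)⁻¹ * W Y) atTop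
      (𝓝 (2 * Real.pi * (-X ^ m * outerPot m g ‖X‖))) := by
  have hXn : 0 < ‖X‖ := norm_pos_iff.2 hX0
  have hnorm : ∀ s : ℝ, 0 < s → ‖X / (s : ℂ)‖ = ‖X‖ / s := fun s hs => by
    rw [norm_div, Complex.norm_real, Real.norm_of_nonneg hs.le]
  obtain ⟨l, rfl⟩ : ∃ l, m = l + 1 := ⟨m - 1, by omega⟩
  rw [outerPot, ← integral_const_mul]
  refine tendsto_mul_setIntegral_cauchy hW hX measurableSet_Ioi (Set.Ioi_subset_Ioi hXn.le)
    ((hg.integrableOn_outer hm hXn).const_mul _) (fun s hsX _ => ?_) (fun s hsX hs hne => ?_)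
  · have hs : 0 < s := hXn.trans hsX
    rw [cauchyMode_natCast_succ,
      circleAverage_div_sub_mul_pow ((hnorm s hs).trans_lt ((div_lt_one hs).2 hsX))]
    ring
  · have hsX' : s < ‖X‖ := lt_of_le_of_ne (not_lt.1 hsX) hne
    rw [cauchyMode_natCast_succ, circleAverage_div_sub_mul_pow_of_one_lt_norm
      (((one_lt_div hs).2 hsX').trans_eq (hnorm s hs).symm), mul_zero]

theorem tendsto_mul_setIntegral_cauchy_neg_natCast {m : ℕ} (hg : RadialL2 g)
    (hW : W =ᵐ[volume] modeFun g (-(m : ℤ))) (hX0 : X ≠ 0)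
    (hX : ∀ ρ : ℝ, IntegrableOn (fun Y => (X - Y)⁻¹ * W Y) (Metric.ball 0 ρ)) :
    Tendsto (fun ρ : ℝ => X * ∫ Y in Metric.ball 0 ρ, (X - Y)⁻¹ * W Y) atTop
      (𝓝 (2 * Real.pi * ((X ^ m)⁻¹ * innerPot m g ‖X‖))) := by
  have hXn : 0 < ‖X‖ := norm_pos_iff.2 hX0
  have hnorm : ∀ s : ℝ, 0 < s → ‖(X / (s : ℂ))⁻¹‖ = s / ‖X‖ := fun s hs => by
    rw [norm_inv, norm_div, Complex.norm_real, Real.norm_of_nonneg hs.le, inv_div]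
  have hcast : ∀ s : ℝ, 0 < s → X / (s : ℂ) ≠ 0 := fun s hs =>
    div_ne_zero hX0 (Complex.ofReal_ne_zero.2 hs.ne')
  rw [innerPot, ← integral_const_mul]
  refine tendsto_mul_setIntegral_cauchy hW hX measurableSet_Ioc Set.Ioc_subset_Ioi_self
    ((hg.integrableOn_inner m _).const_mul _) (fun s hs hne => ?_) (fun s hsX hs _ => ?_)
  · rw [cauchyMode_neg_natCast m (hcast s hs.1), circleAverage_div_sub_mul_pow
      ((hnorm s hs.1).trans_lt ((div_lt_one hXn).2 (lt_of_le_of_ne hs.2 hne))),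
      inv_div, div_pow]
    ring
  · have hsX' : ‖X‖ < s := not_le.1 fun h => hsX ⟨hs, h⟩
    rw [cauchyMode_neg_natCast m (hcast s hs), circleAverage_div_sub_mul_pow_of_one_lt_norm
      (((one_lt_div hXn).2 hsX').trans_eq (hnorm s hs).symm)]

theorem biotSavartTrunc_eq {ρ : ℝ}
    (hX : IntegrableOn (fun Y => (X - Y)⁻¹ * W Y) (Metric.ball 0 ρ))
    (hX' : IntegrableOn (fun Y => (X - Y)⁻¹ * (starRingEnd ℂ) (W Y)) (Metric.ball 0 ρ)) :
    biotSavartTrunc W ρ X =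
      (((∫ Y in Metric.ball 0 ρ, (X - Y)⁻¹ * W Y) -
        (starRingEnd ℂ) (∫ Y in Metric.ball 0 ρ, (X - Y)⁻¹ * (starRingEnd ℂ) (W Y))) /
          (4 * Real.pi * Complex.I),
       ((∫ Y in Metric.ball 0 ρ, (X - Y)⁻¹ * W Y) +
        (starRingEnd ℂ) (∫ Y in Metric.ball 0 ρ, (X - Y)⁻¹ * (starRingEnd ℂ) (W Y))) /
          (4 * Real.pi)) := by
  have hconj : IntegrableOn (fun Y => (starRingEnd ℂ) ((X - Y)⁻¹ * (starRingEnd ℂ) (W Y)))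
      (Metric.ball 0 ρ) := Complex.conjCLE.toContinuousLinearMap.integrable_comp hX'
  rw [← integral_conj, ← integral_sub hX hconj, ← integral_add hX hconj, ← integral_div,
    ← integral_div, biotSavartTrunc]
  simp only [map_mul, Complex.conj_conj, ← sub_mul, ← add_mul, Complex.sub_conj, Complex.add_conj,
    Complex.inv_im, Complex.inv_re, Complex.normSq_eq_norm_sq]
  push_cast
  congr 1 <;> congr 1 <;> ext Y <;> field_simp <;> ring

theorem velocity_radial_eq (hX0 : X ≠ 0)
    (hX : ∀ ρ : ℝ, IntegrableOn (fun Y => (X - Y)⁻¹ * W Y) (Metric.ball 0 ρ))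
    (hX' : ∀ ρ : ℝ, IntegrableOn (fun Y => (X - Y)⁻¹ * (starRingEnd ℂ) (W Y)) (Metric.ball 0 ρ))
    {A B : ℂ}
    (hA : Tendsto (fun ρ : ℝ => X * ∫ Y in Metric.ball 0 ρ, (X - Y)⁻¹ * W Y) atTop (𝓝 A))
    (hB : Tendsto (fun ρ : ℝ => X * ∫ Y in Metric.ball 0 ρ, (X - Y)⁻¹ * (starRingEnd ℂ) (W Y)) atTop
      (𝓝 B)) :
    (velocity W X).1 * (X.re : ℂ) + (velocity W X).2 * (X.im : ℂ) =
      (A - (starRingEnd ℂ) B) / (4 * Real.pi * Complex.I) := by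
  have hA' := hA.const_mul X⁻¹
  have hB' := Complex.continuous_conj.continuousAt.tendsto.comp (hB.const_mul X⁻¹)
  simp only [inv_mul_cancel_left₀ hX0] at hA' hB'
  have hvel : velocity W X =
      ((X⁻¹ * A - (starRingEnd ℂ) (X⁻¹ * B)) / (4 * Real.pi * Complex.I),
        (X⁻¹ * A + (starRingEnd ℂ) (X⁻¹ * B)) / (4 * Real.pi)) :=
    ((((hA'.sub hB').div_const _).prodMk_nhds ((hA'.add hB').div_const _)).congr fun ρ =>
      (biotSavartTrunc_eq (hX ρ) (hX' ρ)).symm).limUnder_eq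
  have hXc : (starRingEnd ℂ) X ≠ 0 := (map_ne_zero _).2 hX0
  have hpi : (Real.pi : ℂ) ≠ 0 := Complex.ofReal_ne_zero.2 Real.pi_ne_zero
  rw [hvel, Complex.re_eq_add_conj, Complex.im_eq_sub_conj, map_mul, map_inv₀]
  field_simp
  ring

theorem velocity_radial (hk : 2 ≤ k.natAbs) (hL : MemLp W 2 volume)
    (hW : W =ᵐ[volume] modeFun g k) :
    ∀ᵐ X : ℂ, (velocity W X).1 * (X.re : ℂ) + (velocity W X).2 * (X.im : ℂ) =
      Complex.I * k.sign / 2 * modeFun (radialPot k.natAbs g) k X := by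
  have hg := RadialL2.of_memLp hL hW
  have hW' : (fun X => (starRingEnd ℂ) (W X)) =ᵐ[volume]
      modeFun (fun s => (starRingEnd ℂ) (g s)) (-k) := by
    filter_upwards [hW, volume.ae_ne 0] with X hX hX0 using hX ▸ conj_modeFun g k hX0
  filter_upwards [volume.ae_ne 0, ae_integrableOn_cauchy (hL.locallyIntegrable one_le_two),
    ae_integrableOn_cauchy (hL.star.locallyIntegrable one_le_two)] with X hX0 hX hX'
  have hXn : (‖X‖ : ℂ) ≠ 0 := Complex.ofReal_ne_zero.2 (norm_ne_zero_iff.2 hX0)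
  have hXc : (starRingEnd ℂ) X = (‖X‖ : ℂ) ^ 2 / X := by
    rw [eq_div_iff hX0, Complex.conj_mul']
  have hpi : (Real.pi : ℂ) ≠ 0 := Complex.ofReal_ne_zero.2 Real.pi_ne_zero
  have hk0 : k ≠ 0 := by omega
  rcases hk0.lt_or_gt with hneg | hpos
  · obtain ⟨m, rfl⟩ : ∃ m : ℕ, k = -m := ⟨k.natAbs, by omega⟩
    rw [Int.natAbs_neg, Int.natAbs_natCast] at hk ⊢
    rw [neg_neg] at hW'
    rw [velocity_radial_eq hX0 hX hX' (tendsto_mul_setIntegral_cauchy_neg_natCast hg hW hX0 hX)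
      (tendsto_mul_setIntegral_cauchy_natCast hk hg.conj hW' hX0 hX'), modeFun, radialPot,
      Int.sign_eq_neg_one_of_neg hneg]
    simp only [map_mul, map_neg, map_pow, conj_outerPot_conj, map_ofNat, Complex.conj_ofReal, hXc,
      zpow_neg, zpow_natCast, div_pow]
    push_cast
    field_simp
    rw [Complex.I_sq]
    ring
  · obtain ⟨m, rfl⟩ : ∃ m : ℕ, k = m := ⟨k.natAbs, by omega⟩
    rw [Int.natAbs_natCast] at hk ⊢
    rw [velocity_radial_eq hX0 hX hX' (tendsto_mul_setIntegral_cauchy_natCast hk hg hW hX0 hX)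
      (tendsto_mul_setIntegral_cauchy_neg_natCast hg.conj hW' hX0 hX'), modeFun, radialPot,
      Int.sign_eq_one_of_pos hpos]
    simp only [map_mul, map_inv₀, map_pow, conj_innerPot_conj, map_ofNat, Complex.conj_ofReal, hXc,
      zpow_natCast, div_pow]
    push_cast
    field_simp
    rw [Complex.I_sq]
    ring

end BiotSavart

section WeakDerivative

open scoped Distributions

variable {E : Type*} [NormedAddCommGroup E] {x₀ x : ℝ}

section Primitive

variable {s : Set ℝ} [hs : s.OrdConnected] {p : ℝ → E}

theorem intervalIntegrable_of_locallyIntegrableOn (hp : LocallyIntegrableOn p s) (hx₀ : x₀ ∈ s)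
    (hx : x ∈ s) : IntervalIntegrable p volume x₀ x :=
  intervalIntegrable_iff.2 <| IntegrableOn.mono_set
    (hp.integrableOn_compact_subset (hs.uIcc_subset hx₀ hx) isCompact_uIcc) Set.uIoc_subset_uIcc

variable [NormedSpace ℝ E]

theorem continuousOn_primitive_of_locallyIntegrableOn (hso : IsOpen s)
    (hp : LocallyIntegrableOn p s) (hx₀ : x₀ ∈ s) :
    ContinuousOn (fun x => ∫ t in x₀..x, p t) s := by
  intro x hx
  obtain ⟨l, u, ⟨hlx, hxu⟩, hlu⟩ := mem_nhds_iff_exists_Ioo_subset.1 (hso.mem_nhds hx)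
  obtain ⟨l', hl'⟩ := exists_between hlx
  obtain ⟨u', hu'⟩ := exists_between hxu
  have hmin : min x₀ l' ∈ s := min_rec' (· ∈ s) hx₀ (hlu ⟨hl'.1, hl'.2.trans hxu⟩)
  have hmax : max x₀ u' ∈ s := max_rec' (· ∈ s) hx₀ (hlu ⟨hlx.trans hu'.1, hu'.2⟩)
  have hcont := intervalIntegral.continuousOn_primitive_interval' (a := x₀)
    (intervalIntegrable_of_locallyIntegrableOn hp hmin hmax)
    (Set.mem_uIcc_of_le (min_le_left _ _) (le_max_left _ _))
  rw [Set.uIcc_of_le ((min_le_left _ _).trans (le_max_left _ _))] at hcont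
  exact (hcont.continuousAt (Icc_mem_nhds ((min_le_right _ _).trans_lt hl'.2)
    (hu'.1.trans_le (le_max_right _ _)))).continuousWithinAt

theorem hasDerivAt_primitive_of_continuousOn [CompleteSpace E] (hso : IsOpen s)
    (hp : ContinuousOn p s) (hx₀ : x₀ ∈ s) (hx : x ∈ s) :
    HasDerivAt (fun x => ∫ t in x₀..x, p t) (p x) x :=
  intervalIntegral.integral_hasDerivAt_right
    (intervalIntegrable_of_locallyIntegrableOn
      (hp.locallyIntegrableOn hso.measurableSet) hx₀ hx)
    (hp.stronglyMeasurableAtFilter hso x hx) (hp.continuousAt (hso.mem_nhds hx))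

end Primitive

variable [NormedSpace ℝ E]

theorem contDiffOn_succ_of_hasDerivAt {s : Set ℝ} (hso : IsOpen s) {n : ℕ} {u v : ℝ → E}
    (hv : ContDiffOn ℝ n v s) (hu : ∀ x ∈ s, HasDerivAt u (v x) x) :
    ContDiffOn ℝ (n + 1 : ℕ) u s := by
  rw [Nat.cast_succ, contDiffOn_succ_iff_deriv_of_isOpen hso]
  exact ⟨fun x hx => (hu x hx).differentiableAt.differentiableWithinAt, by simp,
    hv.congr fun x hx => (hu x hx).deriv⟩

variable {Ω : TopologicalSpace.Opens ℝ} {p q : ℝ → E}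

theorem integrable_testFunction_smul (F : 𝓓(Ω, ℝ)) (hp : LocallyIntegrableOn p Ω) :
    Integrable fun s => F s • p s :=
  F.integrable_bilin (ContinuousLinearMap.lsmul ℝ ℝ) hp

theorem exists_testFunction_eq_deriv (F : 𝓓(Ω, ℝ)) : ∃ G : 𝓓(Ω, ℝ), ⇑G = deriv F := by
  refine ⟨LineDeriv.lineDerivOp (1 : ℝ) F, funext fun s => ?_⟩
  rw [TestFunction.lineDerivOp_eq_lineDerivCLM (𝕜 := ℝ),
    TestFunction.lineDerivCLM_apply_of_le le_top,
    (F.contDiff.differentiable (by simp) s).lineDeriv_eq_fderiv, fderiv_apply_one_eq_deriv]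

theorem integrable_deriv_testFunction_smul (F : 𝓓(Ω, ℝ)) (hp : LocallyIntegrableOn p Ω) :
    Integrable fun s => deriv F s • p s := by
  obtain ⟨G, hG⟩ := exists_testFunction_eq_deriv F
  simpa only [← hG] using integrable_testFunction_smul G hp

theorem setIntegral_testFunction_smul (F : 𝓓(Ω, ℝ)) :
    ∫ s in Ω, F s • p s = ∫ s, F s • p s :=
  setIntegral_eq_integral_of_forall_compl_eq_zero fun s hs => by
    rw [image_eq_zero_of_notMem_tsupport fun h => hs (F.tsupport_subset h), zero_smul]

theorem setIntegral_deriv_testFunction_smul (F : 𝓓(Ω, ℝ)) :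
    ∫ s in Ω, deriv F s • p s = ∫ s, deriv F s • p s := by
  obtain ⟨G, hG⟩ := exists_testFunction_eq_deriv F
  simpa only [← hG] using setIntegral_testFunction_smul G

theorem contDiff_testFunction_smul (F : 𝓓(Ω, ℝ)) (hp : ContDiffOn ℝ ∞ p Ω) :
    ContDiff ℝ ∞ fun s => F s • p s := by
  refine contDiff_iff_contDiffAt.2 fun x => ?_
  by_cases hx : x ∈ tsupport F
  · exact F.contDiff.contDiffAt.smul
      (hp.contDiffAt (Ω.isOpen.mem_nhds (F.tsupport_subset hx)))
  · refine (contDiffAt_const (c := (0 : E))).congr_of_eventuallyEq ?_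
    filter_upwards [notMem_tsupport_iff_eventuallyEq.1 hx] with s hs
    rw [hs, Pi.zero_apply, zero_smul]

theorem integral_deriv_testFunction_smul (F : 𝓓(Ω, ℝ)) (hq : ContinuousOn q Ω)
    (hp : ∀ x ∈ Ω, HasDerivAt p (q x) x) : ∫ s, deriv F s • p s = -∫ s, F s • q s := by
  have hpl : LocallyIntegrableOn p Ω :=
    ContinuousOn.locallyIntegrableOn (fun x hx => (hp x hx).continuousAt.continuousWithinAt)
      Ω.isOpen.measurableSet
  have hql : LocallyIntegrableOn q Ω := hq.locallyIntegrableOn Ω.isOpen.measurableSet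
  have hderiv : ∀ x, HasDerivAt (fun s => F s • p s) (F x • q x + deriv F x • p x) x := by
    intro x
    by_cases hx : x ∈ tsupport F
    · exact (F.contDiff.differentiable (by simp) x).hasDerivAt.smul
        (hp x (F.tsupport_subset hx))
    · have hF : F =ᶠ[𝓝 x] 0 := notMem_tsupport_iff_eventuallyEq.1 hx
      have hFp : (fun s => F s • p s) =ᶠ[𝓝 x] fun _ => 0 := by
        filter_upwards [hF] with s hs
        rw [hs, Pi.zero_apply, zero_smul]
      simpa [hF.eq_of_nhds, hF.deriv_eq] using hFp.hasDerivAt_iff.2 (hasDerivAt_const x 0)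
  have hparts := integral_eq_zero_of_hasDerivAt_of_integrable hderiv
    ((integrable_testFunction_smul F hql).add (integrable_deriv_testFunction_smul F hpl))
    (integrable_testFunction_smul F hpl)
  rw [integral_add (integrable_testFunction_smul F hql)
    (integrable_deriv_testFunction_smul F hpl)] at hparts
  exact eq_neg_of_add_eq_zero_right hparts

theorem exists_testFunction_integral_eq_one (hΩ : (Ω : Set ℝ).Nonempty) :
    ∃ ψ : 𝓓(Ω, ℝ), ∫ x, ψ x = 1 := by
  obtain ⟨c, hc⟩ := hΩ
  obtain ⟨r, hr, hball⟩ := Metric.isOpen_iff.1 Ω.isOpen c hc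
  let f : ContDiffBump c := ⟨r / 4, r / 2, by positivity, by linarith⟩
  refine ⟨⟨f.normed volume, f.contDiff_normed, f.hasCompactSupport_normed, ?_⟩,
    f.integral_normed⟩
  rw [f.tsupport_normed_eq]
  exact (Metric.closedBall_subset_ball (half_lt_self hr)).trans hball

theorem contDiff_primitive [CompleteSpace E] (hp : ContDiff ℝ ∞ p) (x₀ : ℝ) :
    ContDiff ℝ ∞ fun x => ∫ t in x₀..x, p t := by
  have hderiv : ∀ x, HasDerivAt (fun x => ∫ t in x₀..x, p t) (p x) x := fun x =>
    (hp.continuous.integral_hasStrictDerivAt x₀ x).hasDerivAt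
  rw [contDiff_infty_iff_deriv, funext fun x => (hderiv x).deriv]
  exact ⟨fun x => (hderiv x).differentiableAt, hp⟩

theorem exists_tsupport_testFunction_subset_Icc (hne : (Ω : Set ℝ).Nonempty) (F : 𝓓(Ω, ℝ)) :
    ∃ l ∈ Ω, ∃ u ∈ Ω, tsupport F ⊆ Set.Icc l u := by
  have hF : IsCompact (tsupport F) := F.hasCompactSupport
  rcases (tsupport F).eq_empty_or_nonempty with hempty | hF_ne
  · obtain ⟨x₀, hx₀⟩ := hne
    exact ⟨x₀, hx₀, x₀, hx₀, hempty ▸ Set.empty_subset _⟩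
  · exact ⟨_, F.tsupport_subset (hF.sInf_mem hF_ne), _, F.tsupport_subset (hF.sSup_mem hF_ne),
      hF.isBounded.subset_Icc_sInf_sSup⟩

theorem exists_testFunction_deriv_eq (hΩ : (Ω : Set ℝ).OrdConnected) (hne : (Ω : Set ℝ).Nonempty)
    (ψ : 𝓓(Ω, ℝ)) (hψ : ∫ x, ψ x = 0) : ∃ F : 𝓓(Ω, ℝ), deriv F = ψ := by
  have hint : Integrable ψ := ψ.continuous.integrable_of_hasCompactSupport ψ.hasCompactSupport
  set F : ℝ → ℝ := fun x => ∫ t in Set.Iic x, ψ t with hF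
  have hF_eq : F = fun x => (∫ t in Set.Iic 0, ψ t) + ∫ t in (0 : ℝ)..x, ψ t := by
    ext x
    rw [← intervalIntegral.integral_Iic_sub_Iic hint.integrableOn hint.integrableOn]
    ring
  have hF_compl : ∀ x, F x = -∫ t in Set.Ioi x, ψ t := fun x => by
    rw [eq_neg_iff_add_eq_zero, hF, ← Set.compl_Iic, integral_add_compl measurableSet_Iic hint, hψ]
  have hF_deriv : deriv F = ψ := funext fun x => by
    rw [hF_eq, deriv_const_add, ψ.continuous.deriv_integral]
  obtain ⟨l, hl, u, hu, hlu⟩ := exists_tsupport_testFunction_subset_Icc hne ψ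
  have htsupp : tsupport F ⊆ Set.Icc l u := by
    refine closure_minimal (fun x hx => ?_) isClosed_Icc
    obtain ⟨y, hyx, hy⟩ : ∃ y ∈ Set.Iic x, ψ y ≠ 0 := by
      contrapose! hx
      simpa using setIntegral_eq_zero_of_forall_eq_zero hx
    obtain ⟨z, hxz, hz⟩ : ∃ z ∈ Set.Ioi x, ψ z ≠ 0 := by
      contrapose! hx
      simpa [hF_compl] using setIntegral_eq_zero_of_forall_eq_zero hx
    exact ⟨(hlu (subset_tsupport _ hy)).1.trans hyx,
      (le_of_lt hxz).trans (hlu (subset_tsupport _ hz)).2⟩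
  refine ⟨⟨F, ?_, isCompact_Icc.of_isClosed_subset (isClosed_tsupport _) htsupp,
    htsupp.trans (hΩ.out hl hu)⟩, hF_deriv⟩
  rw [hF_eq]
  exact contDiff_const.add (contDiff_primitive ψ.contDiff 0)

variable [CompleteSpace E]

theorem ae_eq_const_of_integral_deriv_testFunction_smul_eq_zero (hΩ : (Ω : Set ℝ).OrdConnected)
    (hne : (Ω : Set ℝ).Nonempty) (hp : LocallyIntegrableOn p Ω)
    (h : ∀ F : 𝓓(Ω, ℝ), ∫ s, deriv F s • p s = 0) :
    ∃ C : E, p =ᵐ[volume.restrict Ω] fun _ => C := by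
  obtain ⟨ψ₀, hψ₀⟩ := exists_testFunction_integral_eq_one hne
  have hint : ∀ ψ : 𝓓(Ω, ℝ), Integrable ψ := fun ψ =>
    ψ.continuous.integrable_of_hasCompactSupport ψ.hasCompactSupport
  set C : E := ∫ s, ψ₀ s • p s
  have hC : ∀ ψ : 𝓓(Ω, ℝ), ∫ s, ψ s • p s = (∫ s, ψ s) • C := by
    intro ψ
    obtain ⟨F, hF⟩ := exists_testFunction_deriv_eq hΩ hne (ψ - (∫ s, ψ s) • ψ₀) (by
      simp [integral_sub (hint ψ) ((hint ψ₀).const_mul _), integral_const_mul, hψ₀])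
    have hFp := h F
    rw [hF] at hFp
    simp only [FunLike.coe_sub, FunLike.coe_smul, Pi.sub_apply, Pi.smul_apply, sub_smul,
      smul_assoc] at hFp
    rwa [integral_sub (integrable_testFunction_smul ψ hp)
      ((integrable_testFunction_smul ψ₀ hp).fun_smul _), integral_smul, sub_eq_zero] at hFp
  have hconst : LocallyIntegrableOn (fun _ : ℝ => C) Ω :=
    continuousOn_const.locallyIntegrableOn Ω.isOpen.measurableSet
  have hzero := Ω.isOpen.ae_eq_zero_of_integral_contDiff_smul_eq_zero (μ := volume)
    (f := fun s => p s - C) (hp.sub hconst) fun ψ hψ hψc hψΩ => by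
      let Ψ : 𝓓(Ω, ℝ) := ⟨ψ, hψ, hψc, hψΩ⟩
      change ∫ s, Ψ s • (p s - C) = 0
      simp only [smul_sub]
      rw [integral_sub (integrable_testFunction_smul Ψ hp)
        (integrable_testFunction_smul Ψ hconst), integral_smul_const, hC, sub_self]
  refine ⟨C, (ae_restrict_iff' Ω.isOpen.measurableSet).2 ?_⟩
  filter_upwards [hzero] with s hs hsΩ using sub_eq_zero.1 (hs hsΩ)

theorem exists_ae_eq_hasDerivAt_of_weak_deriv (hΩ : (Ω : Set ℝ).OrdConnected)
    (hne : (Ω : Set ℝ).Nonempty) (hp : LocallyIntegrableOn p Ω) (hq : ContinuousOn q Ω)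
    (h : ∀ F : 𝓓(Ω, ℝ), ∫ s, deriv F s • p s = -∫ s, F s • q s) :
    ∃ u : ℝ → E, p =ᵐ[volume.restrict Ω] u ∧ ∀ x ∈ Ω, HasDerivAt u (q x) x := by
  obtain ⟨x₀, hx₀⟩ := hne
  set Q : ℝ → E := fun x => ∫ t in x₀..x, q t
  have hQ : ∀ x ∈ Ω, HasDerivAt Q (q x) x := fun x hx =>
    hasDerivAt_primitive_of_continuousOn (hs := hΩ) Ω.isOpen hq hx₀ hx
  have hQl : LocallyIntegrableOn Q Ω :=
    ContinuousOn.locallyIntegrableOn (fun x hx => (hQ x hx).continuousAt.continuousWithinAt)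
      Ω.isOpen.measurableSet
  obtain ⟨C, hC⟩ := ae_eq_const_of_integral_deriv_testFunction_smul_eq_zero hΩ ⟨x₀, hx₀⟩
    (hp.sub hQl) fun F => by
      simp only [Pi.sub_apply, smul_sub]
      rw [integral_sub (integrable_deriv_testFunction_smul F hp)
        (integrable_deriv_testFunction_smul F hQl), h F,
        integral_deriv_testFunction_smul F hq hQ, sub_self]
  refine ⟨fun x => Q x + C, ?_, fun x hx => (hQ x hx).add_const C⟩
  filter_upwards [hC] with s hs
  rw [← hs, Pi.sub_apply, add_sub_cancel]

end WeakDerivative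

section VortexProfile

namespace VortexData

/-- The primitive of the mollifier, a smooth step from `0` to `1`, in terms of which the vortex
profile has a single formula. -/
noncomputable def step (P : VortexData) (x : ℝ) : ℝ := ∫ t in (-1 : ℝ)..x, P.η t

namespace Admissible

variable {P : VortexData} {r : ℝ}

theorem ε_lt_r₁ (hP : P.Admissible) : P.ε < P.r₁ := by
  linarith [hP.ε_lt, min_le_left P.r₁ (P.r₂ - P.r₁), hP.r₁_pos]

theorem three_mul_ε_lt (hP : P.Admissible) : 3 * P.ε < P.r₂ - P.r₁ := by
  linarith [hP.ε_lt, min_le_right P.r₁ (P.r₂ - P.r₁)]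

theorem contDiff_step (hP : P.Admissible) : ContDiff ℝ ∞ P.step :=
  contDiff_primitive hP.η_smooth _

theorem step_of_le (hP : P.Admissible) {x : ℝ} (hx : x ≤ -1) : P.step x = 0 := by
  rw [step, intervalIntegral.integral_symm, neg_eq_zero]
  refine intervalIntegral.integral_zero_ae (.of_forall fun t ht => ?_)
  rw [Set.uIoc_of_le hx] at ht
  exact image_eq_zero_of_notMem_tsupport fun h => ht.2.not_gt (hP.η_supp h).1

theorem step_of_ge (hP : P.Admissible) {x : ℝ} (hx : 1 ≤ x) : P.step x = 1 := by
  rw [step, intervalIntegral.integral_eq_integral_of_support_subset, hP.η_integral]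
  exact fun t ht => ⟨(hP.η_supp (subset_tsupport _ ht)).1,
    (hP.η_supp (subset_tsupport _ ht)).2.le.trans hx⟩

theorem step_eq_zero (hP : P.Admissible) {ρ : ℝ} (hr : r ≤ ρ - P.ε) :
    P.step ((r - ρ) / P.ε) = 0 :=
  hP.step_of_le (by rw [div_le_iff₀ hP.ε_pos]; linarith)

theorem step_eq_one (hP : P.Admissible) {ρ : ℝ} (hr : ρ + P.ε ≤ r) :
    P.step ((r - ρ) / P.ε) = 1 :=
  hP.step_of_ge (by rw [le_div_iff₀ hP.ε_pos]; linarith)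

theorem cutoff_eq (hP : P.Admissible) (r : ℝ) :
    P.cutoff r = P.step ((r - P.r₁) / P.ε) - P.step ((r - P.r₂) / P.ε) := by
  have hint : ∀ a b : ℝ, IntervalIntegrable P.η volume a b := fun a b =>
    hP.η_smooth.continuous.intervalIntegrable _ _
  rw [step, step, intervalIntegral.integral_interval_sub_left (hint _ _) (hint _ _), cutoff,
    intervalIntegral.integral_const_mul]
  simp only [sub_div]
  rw [intervalIntegral.integral_comp_sub_div _ hP.ε_pos.ne', smul_eq_mul,
    inv_mul_cancel_left₀ hP.ε_pos.ne']

theorem vθ_eq (hP : P.Admissible) (r : ℝ) :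
    P.vθ r = P.v₁ r * (1 - P.step ((r - P.r₁) / P.ε)) +
      P.v₂ r * (P.step ((r - P.r₁) / P.ε) * (1 - P.step ((r - P.r₂) / P.ε))) := by
  have hε := hP.ε_pos
  have hgap := hP.three_mul_ε_lt
  rw [vθ, vSharp]
  split_ifs with h₁ h₂ hr₁ hr₂ <;> simp only [abs_lt, not_le] at *
  · rw [hP.cutoff_eq, hP.step_eq_zero (ρ := P.r₂) (by linarith)]
    ring
  · rw [hP.cutoff_eq, hP.step_eq_one (ρ := P.r₁) (by linarith)]
    ring
  · rw [hP.step_eq_zero (ρ := P.r₁) (by grind)]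
    ring
  · rw [hP.step_eq_one (ρ := P.r₁) (by grind), hP.step_eq_zero (ρ := P.r₂) (by grind)]
    ring
  · rw [hP.step_eq_one (ρ := P.r₁) (by grind), hP.step_eq_one (ρ := P.r₂) (by grind)]
    ring

theorem contDiffOn_vθ (hP : P.Admissible) : ContDiffOn ℝ ∞ P.vθ (Set.Ioi 0) := by
  have hstep : ∀ ρ : ℝ, ContDiffOn ℝ ∞ (fun r => P.step ((r - ρ) / P.ε)) (Set.Ioi 0) := fun ρ =>
    (hP.contDiff_step.comp (by fun_prop : ContDiff ℝ ∞ fun r => (r - ρ) / P.ε)).contDiffOn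
  have hv₁ : ContDiffOn ℝ ∞ P.v₁ (Set.Ioi 0) := by
    unfold v₁
    fun_prop
  have hv₂ : ContDiffOn ℝ ∞ P.v₂ (Set.Ioi 0) :=
    (contDiffOn_id.div_const 2).mul
      (((contDiffOn_const.div contDiffOn_id fun x hx => hx.ne').pow 2).sub contDiffOn_const)
  exact ((hv₁.mul (contDiffOn_const.sub (hstep _))).add
    (hv₂.mul ((hstep _).mul (contDiffOn_const.sub (hstep _))))).congr fun r _ => hP.vθ_eq r

theorem vθ_of_le (hP : P.Admissible) (hr : r ≤ P.r₁ - P.ε) : P.vθ r = P.c * r / 2 := by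
  rw [hP.vθ_eq, hP.step_eq_zero hr, v₁]
  ring

theorem vθ_of_ge (hP : P.Admissible) (hr : P.r₂ + P.ε ≤ r) : P.vθ r = 0 := by
  rw [hP.vθ_eq, hP.step_eq_one (ρ := P.r₁) (by linarith [hP.r₁_lt_r₂]), hP.step_eq_one hr]
  ring

theorem contDiffOn_w (hP : P.Admissible) : ContDiffOn ℝ ∞ P.w (Set.Ioi 0) := by
  have hderiv : ContDiffOn ℝ ∞ (deriv fun s => s * P.vθ s) (Set.Ioi 0) :=
    (contDiffOn_id.mul hP.contDiffOn_vθ).deriv_of_isOpen isOpen_Ioi (by simp)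
  exact (hderiv.div contDiffOn_id fun x hx => hx.ne').congr fun x hx => if_neg (ne_of_gt hx)

theorem w_of_lt (hP : P.Admissible) (hr0 : 0 < r) (hr : r < P.r₁ - P.ε) : P.w r = P.c := by
  have hloc : (fun s => s * P.vθ s) =ᶠ[𝓝 r] fun s => P.c / 2 * s ^ 2 := by
    filter_upwards [Iio_mem_nhds hr] with s hs
    rw [hP.vθ_of_le (le_of_lt hs)]
    ring
  rw [w, if_neg hr0.ne', hloc.deriv_eq, deriv_const_mul_field, deriv_pow_field]
  field_simp
  norm_num

theorem w_of_gt (hP : P.Admissible) (hr : P.r₂ + P.ε < r) : P.w r = 0 := by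
  have hr0 : 0 < r := by linarith [hP.r₁_pos, hP.r₁_lt_r₂, hP.ε_pos]
  have hloc : (fun s => s * P.vθ s) =ᶠ[𝓝 r] fun _ => 0 := by
    filter_upwards [Ioi_mem_nhds hr] with s hs
    rw [hP.vθ_of_ge (le_of_lt hs), mul_zero]
  rw [w, if_neg hr0.ne', hloc.deriv_eq, deriv_const, zero_div]

theorem deriv_w_of_lt (hP : P.Admissible) (hr0 : 0 < r) (hr : r < P.r₁ - P.ε) :
    deriv P.w r = 0 := by
  have hloc : P.w =ᶠ[𝓝 r] fun _ => P.c := by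
    filter_upwards [Ioo_mem_nhds hr0 hr] with x hx using hP.w_of_lt hx.1 hx.2
  rw [hloc.deriv_eq, deriv_const]

theorem deriv_w_of_gt (hP : P.Admissible) (hr : P.r₂ + P.ε < r) : deriv P.w r = 0 := by
  have hloc : P.w =ᶠ[𝓝 r] fun _ => 0 := by
    filter_upwards [Ioi_mem_nhds hr] with x hx using hP.w_of_gt hx
  rw [hloc.deriv_eq, deriv_const]

end Admissible

end VortexData

end VortexProfile

section PolarDerivatives

theorem fderiv_comp_norm_apply {V F : Type*} [NormedAddCommGroup V] [InnerProductSpace ℝ V]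
    [NormedAddCommGroup F] [NormedSpace ℝ F] {h : ℝ → F} {x : V} (hx : x ≠ 0)
    (hh : DifferentiableAt ℝ h ‖x‖) (v : V) :
    fderiv ℝ (fun y : V => h ‖y‖) x v = (inner ℝ x v / ‖x‖) • deriv h ‖x‖ := by
  have hnorm : DifferentiableAt ℝ (fun y : V => ‖y‖) x :=
    (contDiffAt_norm ℝ hx (n := 1)).differentiableAt one_ne_zero
  have hsq := DFunLike.congr_fun ((hnorm.hasFDerivAt.pow 2).unique
    (hasStrictFDerivAt_norm_sq x).hasFDerivAt) v
  simp only [Nat.add_one_sub_one, pow_one, smul_apply, smul_eq_mul, innerSL_apply_apply,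
    nsmul_eq_mul, Nat.cast_ofNat] at hsq
  have hcomp : HasFDerivAt (fun y : V => h ‖y‖) _ x :=
    hh.hasDerivAt.hasFDerivAt.comp x hnorm.hasFDerivAt
  rw [hcomp.fderiv, ContinuousLinearMap.comp_apply, ContinuousLinearMap.toSpanSingleton_apply]
  congr 1
  rw [eq_div_iff (norm_ne_zero_iff.2 hx)]
  linarith

variable {f : ℝ → ℂ} {X : ℂ}

theorem real_inner_self_mul (X ζ : ℂ) : inner ℝ X (X * ζ) = ζ.re * ‖X‖ ^ 2 := by
  rw [Complex.inner, mul_right_comm, Complex.mul_conj', mul_comm, ← Complex.ofReal_pow,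
    Complex.re_mul_ofReal]

theorem fderiv_unit_zpow_apply (k : ℤ) (hX : X ≠ 0) (ζ : ℂ) :
    fderiv ℝ (fun Y : ℂ => (Y / (‖Y‖ : ℂ)) ^ k) X (X * ζ) =
      Complex.I * k * ζ.im * (X / (‖X‖ : ℂ)) ^ k := by
  have hlin : ∀ w : ℂ, HasDerivAt (fun t : ℝ => (t : ℂ) * w) w 0 := fun w => by
    simpa using (hasDerivAt_id (0 : ℝ)).ofReal_comp.mul_const w
  have hspiral : HasDerivAt (fun t : ℝ => X * Complex.exp (t * ζ)) (X * ζ) 0 := by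
    simpa using (hlin ζ).cexp.const_mul X
  have hrotate : ∀ t : ℝ, (X * Complex.exp (t * ζ) / (‖X * Complex.exp (t * ζ)‖ : ℂ)) ^ k =
      (X / (‖X‖ : ℂ)) ^ k * Complex.exp (t * (Complex.I * k * ζ.im)) := by
    intro t
    have hexp : Complex.exp (t * ζ) / ‖Complex.exp (t * ζ)‖ =
        Complex.exp (t * ζ.im * Complex.I) := by
      rw [Complex.norm_exp, Complex.ofReal_exp, ← Complex.exp_sub, Complex.re_ofReal_mul]
      nth_rw 1 [← Complex.re_add_im ζ]
      push_cast
      congr 1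
      ring
    rw [norm_mul, Complex.ofReal_mul, mul_div_mul_comm, hexp, mul_zpow, ← Complex.exp_int_mul]
    congr 2
    ring
  have hdiff : DifferentiableAt ℝ (fun Y : ℂ => (Y / (‖Y‖ : ℂ)) ^ k) X :=
    (contDiffAt_unit_zpow k hX).differentiableAt (by simp)
  have hcurve := HasFDerivAt.comp_hasDerivAt_of_eq (0 : ℝ) hdiff.hasFDerivAt hspiral (by simp)
  have hright := (hlin (Complex.I * k * ζ.im)).cexp.const_mul ((X / (‖X‖ : ℂ)) ^ k)
  rw [(hcurve.congr_of_eventuallyEq (.of_forall fun t => (hrotate t).symm)).unique hright]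
  simp [mul_comm]

theorem contDiffAt_modeFun (k : ℤ) (hX : X ≠ 0) (hf : ContDiffAt ℝ ∞ f ‖X‖) :
    ContDiffAt ℝ ∞ (modeFun f k) X :=
  (hf.comp X (contDiffAt_norm ℝ hX)).mul (contDiffAt_unit_zpow k hX)

theorem fderiv_modeFun_apply (k : ℤ) (hX : X ≠ 0) (hf : DifferentiableAt ℝ f ‖X‖) (ζ : ℂ) :
    fderiv ℝ (modeFun f k) X (X * ζ) =
      (ζ.re * ‖X‖ * deriv f ‖X‖ + Complex.I * k * ζ.im * f ‖X‖) * (X / (‖X‖ : ℂ)) ^ k := by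
  have hnorm : DifferentiableAt ℝ (fun Y : ℂ => ‖Y‖) X :=
    (contDiffAt_norm ℝ hX (n := 1)).differentiableAt one_ne_zero
  have hunit : DifferentiableAt ℝ (fun Y : ℂ => (Y / (‖Y‖ : ℂ)) ^ k) X :=
    (contDiffAt_unit_zpow k hX).differentiableAt (by simp)
  have hfn : DifferentiableAt ℝ (fun Y : ℂ => f ‖Y‖) X := hf.comp X hnorm
  change fderiv ℝ (fun Y => f ‖Y‖ * (Y / (‖Y‖ : ℂ)) ^ k) X (X * ζ) = _
  rw [fderiv_fun_mul hfn hunit, add_apply, smul_apply, smul_apply, fderiv_unit_zpow_apply k hX,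
    fderiv_comp_norm_apply hX hf, real_inner_self_mul, sq, ← mul_assoc,
    mul_div_cancel_right₀ _ (norm_ne_zero_iff.2 hX), Complex.real_smul]
  push_cast
  simp only [smul_eq_mul]
  ring

theorem contDiff_modeFun (k : ℤ) (hf : ContDiff ℝ ∞ f) (hs : tsupport f ⊆ Set.Ioi 0) :
    ContDiff ℝ ∞ (modeFun f k) := by
  refine contDiff_iff_contDiffAt.2 fun X => ?_
  rcases eq_or_ne X 0 with rfl | hX
  · have hf0 : f =ᶠ[𝓝 0] 0 := notMem_tsupport_iff_eventuallyEq.1 fun h => lt_irrefl (0 : ℝ) (hs h)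
    refine (contDiffAt_const (c := (0 : ℂ))).congr_of_eventuallyEq ?_
    filter_upwards [(tendsto_norm_zero (E := ℂ)).eventually hf0] with X hX
    rw [modeFun, hX, Pi.zero_apply, zero_mul]
  · exact contDiffAt_modeFun k hX hf.contDiffAt

theorem hasCompactSupport_modeFun (k : ℤ) {M : ℝ} (hf : ∀ r, M < r → f r = 0) :
    HasCompactSupport (modeFun f k) := by
  refine HasCompactSupport.intro (isCompact_closedBall (0 : ℂ) M) fun X hX => ?_
  rw [modeFun, hf _ (not_le.1 fun h => hX (mem_closedBall_zero_iff.2 h)), zero_mul]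

theorem isHomogNearZero_modeFun (k : ℤ) {z : ℂ} {M ρ : ℝ} (hf : ContDiffOn ℝ ∞ f (Set.Ioi 0))
    (hM : ∀ r, M < r → f r = 0) (hρ : 0 < ρ)
    (hz : ∀ s t : ℝ, 0 < s → s < ρ → 0 < t → t ≤ 1 → f (t * s) = (t : ℂ) ^ z * f s) :
    IsHomogNearZero z (modeFun f k) where
  contDiffOn X hX := (contDiffAt_modeFun k hX
    (hf.contDiffAt (Ioi_mem_nhds (norm_pos_iff.2 hX)))).contDiffWithinAt
  hasCompactSupport := hasCompactSupport_modeFun k hM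
  exists_radius := by
    refine ⟨ρ, hρ, fun X hX hXρ t ht ht1 => ?_⟩
    have hnorm : ‖t • X‖ = t * ‖X‖ := by rw [norm_smul, Real.norm_of_nonneg ht.le]
    rw [modeFun, hnorm, hz _ _ (norm_pos_iff.2 hX) hXρ ht ht1, modeFun, smul_eq_mul, mul_assoc,
      Complex.ofReal_mul, Complex.real_smul,
      mul_div_mul_left X _ (Complex.ofReal_ne_zero.2 ht.ne')]

end PolarDerivatives

section RadialEquation

variable {P : VortexData} {W D : ℂ → ℂ} {g d : ℝ → ℂ} {k : ℤ}

theorem VortexData.Vb_eq (P : VortexData) (b : ℝ) {X : ℂ} (hX : X ≠ 0) :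
    P.Vb b X = X * (Complex.I * (P.vθ ‖X‖ / ‖X‖ : ℝ) - b) := by
  have hXn : (‖X‖ : ℂ) ≠ 0 := Complex.ofReal_ne_zero.2 (norm_ne_zero_iff.2 hX)
  rw [Vb, Vbar]
  push_cast
  field_simp

theorem VortexData.Admissible.K_ae_eq_modeFun (hP : P.Admissible) (hk : 2 ≤ k.natAbs)
    (hL : MemLp W 2 volume) (hW : W =ᵐ[volume] modeFun g k) :
    P.K W =ᵐ[volume] modeFun
      (fun s => -((deriv P.w s : ℝ) : ℂ) / s *
        (Complex.I * k.sign / 2 * radialPot k.natAbs g s)) k := by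
  filter_upwards [velocity_radial hk hL hW, volume.ae_ne 0] with X hX hX0
  have hw : DifferentiableAt ℝ P.w ‖X‖ :=
    (hP.contDiffOn_w.contDiffAt (Ioi_mem_nhds (norm_pos_iff.2 hX0))).differentiableAt (by simp)
  have hΩ : ∀ v : ℂ, fderiv ℝ P.Ωbar X v = inner ℝ X v / ‖X‖ * deriv P.w ‖X‖ :=
    fderiv_comp_norm_apply hX0 hw
  simp only [modeFun] at hX ⊢
  rw [K, hΩ, hΩ, Complex.inner, Complex.inner]
  simp only [one_mul, Complex.conj_re, Complex.I_mul_re, Complex.conj_im, neg_neg]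
  push_cast
  linear_combination (-((deriv P.w ‖X‖ : ℝ) : ℂ) / ‖X‖) * hX

theorem integral_radial_of_isWeakDiv {V : ℂ → ℂ} {α : ℝ → ℝ} {b : ℝ}
    (hV : ∀ X ≠ 0, V X = X * (Complex.I * α ‖X‖ - b)) (hW : W =ᵐ[volume] modeFun g k)
    (hD : D =ᵐ[volume] modeFun d k) (hWD : IsWeakDiv V W D) {f : ℝ → ℂ} (hf : ContDiff ℝ ∞ f)
    (hfc : HasCompactSupport f) (hf0 : tsupport f ⊆ Set.Ioi 0) :
    ∫ s in Set.Ioi (0 : ℝ), s * (g s * (-b * s * deriv f s - Complex.I * k * α s * f s)) =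
      -∫ s in Set.Ioi (0 : ℝ), s * (d s * f s) := by
  have hunit : ∀ X : ℂ, X ≠ 0 → (X / (‖X‖ : ℂ)) ^ k * (X / (‖X‖ : ℂ)) ^ (-k) = 1 := fun X hX => by
    rw [zpow_neg, mul_inv_cancel₀ (unit_zpow_ne_zero hX k)]
  obtain ⟨M, hM⟩ := hfc.isCompact.bddAbove
  have hleft : ∫ X, W X * fderiv ℝ (modeFun f (-k)) X (V X) = ∫ X : ℂ,
      g ‖X‖ * (-b * ‖X‖ * deriv f ‖X‖ - Complex.I * k * α ‖X‖ * f ‖X‖) := by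
    refine integral_congr_ae ?_
    filter_upwards [hW, volume.ae_ne 0] with X hX hX0
    have hre : (Complex.I * α ‖X‖ - b).re = -b := by simp
    have him : (Complex.I * α ‖X‖ - b).im = α ‖X‖ := by simp
    rw [hV X hX0, fderiv_modeFun_apply _ hX0 (hf.differentiable (by simp) _), hX, modeFun, hre, him]
    push_cast
    linear_combination (g ‖X‖ * (-b * ‖X‖ * deriv f ‖X‖ - Complex.I * k * α ‖X‖ * f ‖X‖)) *
      hunit X hX0
  have hright : ∫ X, D X * modeFun f (-k) X = ∫ X : ℂ, d ‖X‖ * f ‖X‖ := by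
    refine integral_congr_ae ?_
    filter_upwards [hD, volume.ae_ne 0] with X hX hX0
    rw [hX, modeFun, modeFun]
    linear_combination (d ‖X‖ * f ‖X‖) * hunit X hX0
  have htest := hWD (modeFun f (-k)) (contDiff_modeFun _ hf hf0)
    (hasCompactSupport_modeFun _ fun r hr =>
      image_eq_zero_of_notMem_tsupport fun h => (hM h).not_gt hr)
  rw [hleft, hright,
    integral_comp_norm fun s => g s * (-b * s * deriv f s - Complex.I * k * α s * f s),
    integral_comp_norm fun s => d s * f s, ← smul_neg] at htest
  simpa only [Complex.real_smul] using smul_right_injective ℂ Real.two_pi_pos.ne' htest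

end RadialEquation

section RadialPotentialRegularity

open scoped Distributions

/-- The open half-line `(0, ∞)` of radii, as a domain for test functions. -/
def halfLine : TopologicalSpace.Opens ℝ := ⟨Set.Ioi 0, isOpen_Ioi⟩

variable {g : ℝ → ℂ} {m : ℕ} {R : ℝ}

theorem RadialL2.locallyIntegrableOn (hg : RadialL2 g) : LocallyIntegrableOn g (Set.Ioi 0) := by
  refine (locallyIntegrableOn_iff isOpen_Ioi.isLocallyClosed).2 fun K hK hKc => ?_
  have hinv : IntegrableOn (fun s : ℝ => s⁻¹ * 1 ^ 2) K :=
    ((continuousOn_inv₀.mono fun s hs => (hK hs).ne').mul continuousOn_const).integrableOn_compact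
      hKc
  simpa only [Complex.ofReal_one, one_mul] using
    hg.integrableOn_mul hKc.measurableSet hK measurable_const hinv

theorem innerPot_eq_add_integral (hg : RadialL2 g) (m : ℕ) (hR : 0 < R) :
    innerPot m g R = innerPot m g 1 + ∫ s in (1 : ℝ)..R, (s : ℂ) ^ (m + 1) * g s := by
  have hint : ∀ {r : ℝ}, 0 ≤ r →
      IntervalIntegrable (fun s : ℝ => (s : ℂ) ^ (m + 1) * g s) volume 0 r := fun hr =>
    (intervalIntegrable_iff_integrableOn_Ioc_of_le hr).2 (hg.integrableOn_inner m _)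
  rw [innerPot, innerPot, ← intervalIntegral.integral_of_le hR.le,
    ← intervalIntegral.integral_of_le zero_le_one,
    intervalIntegral.integral_add_adjacent_intervals (hint zero_le_one)
      ((hint zero_le_one).symm.trans (hint hR.le))]

theorem outerPot_eq_sub_integral (hg : RadialL2 g) (hm : 2 ≤ m) (hR : 0 < R) :
    outerPot m g R = outerPot m g 1 - ∫ s in (1 : ℝ)..R, (s : ℂ) * ((s : ℂ) ^ m)⁻¹ * g s := by
  rw [outerPot, outerPot, ← intervalIntegral.integral_interval_add_Ioi
    (hg.integrableOn_outer hm one_pos) (hg.integrableOn_outer hm hR), add_sub_cancel_left]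

theorem contDiff_ofReal_pow (j : ℕ) {n : WithTop ℕ∞} : ContDiff ℝ n fun s : ℝ => (s : ℂ) ^ j :=
  Complex.ofRealCLM.contDiff.pow j

theorem contDiffOn_inv_ofReal_pow (j : ℕ) {n : WithTop ℕ∞} :
    ContDiffOn ℝ n (fun s : ℝ => ((s : ℂ) ^ j)⁻¹) (Set.Ioi 0) :=
  (contDiff_ofReal_pow j).contDiffOn.inv fun _ hx =>
    pow_ne_zero _ (Complex.ofReal_ne_zero.2 (ne_of_gt hx))

theorem contDiffOn_ofReal_mul_inv_pow (j : ℕ) {n : WithTop ℕ∞} :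
    ContDiffOn ℝ n (fun s : ℝ => (s : ℂ) * ((s : ℂ) ^ j)⁻¹) (Set.Ioi 0) :=
  Complex.ofRealCLM.contDiff.contDiffOn.mul (contDiffOn_inv_ofReal_pow j)

theorem contDiffOn_div_ofReal_pow (j : ℕ) {n : WithTop ℕ∞} (hg : ContDiffOn ℝ n g (Set.Ioi 0)) :
    ContDiffOn ℝ n (fun s : ℝ => g s / (s : ℂ) ^ j) (Set.Ioi 0) := by
  simp only [div_eq_mul_inv]
  exact hg.mul (contDiffOn_inv_ofReal_pow j)

theorem contDiffOn_radialPot_of_primitive {n : WithTop ℕ∞} (hg : RadialL2 g) (hm : 2 ≤ m)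
    (h : ∀ q : ℝ → ℂ, ContDiffOn ℝ n q (Set.Ioi 0) →
      ContDiffOn ℝ n (fun R => ∫ s in (1 : ℝ)..R, q s * g s) (Set.Ioi 0)) :
    ContDiffOn ℝ n (radialPot m g) (Set.Ioi 0) := by
  have hinner := h _ (contDiff_ofReal_pow (m + 1)).contDiffOn
  have houter := h _ (contDiffOn_ofReal_mul_inv_pow m)
  refine (((contDiffOn_inv_ofReal_pow m).mul
    ((contDiffOn_const (c := innerPot m g 1)).add hinner)).add
    ((contDiff_ofReal_pow m).contDiffOn.mul
      ((contDiffOn_const (c := outerPot m g 1)).sub houter))).congr fun R hR => ?_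
  rw [radialPot, innerPot_eq_add_integral hg m hR, outerPot_eq_sub_integral hg hm hR]

theorem continuousOn_radialPot (hg : RadialL2 g) (hm : 2 ≤ m) :
    ContinuousOn (radialPot m g) (Set.Ioi 0) :=
  contDiffOn_zero.1 <| contDiffOn_radialPot_of_primitive hg hm fun _ hq => contDiffOn_zero.2 <|
    continuousOn_primitive_of_locallyIntegrableOn isOpen_Ioi
      (hg.locallyIntegrableOn.continuousOn_mul hq.continuousOn isOpen_Ioi.isLocallyClosed)
      (Set.mem_Ioi.2 one_pos)

theorem contDiffOn_radialPot {g' : ℝ → ℂ} {n : ℕ} (hg : RadialL2 g) (hm : 2 ≤ m)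
    (hgg' : g =ᵐ[volume.restrict (Set.Ioi 0)] g') (hg' : ContDiffOn ℝ n g' (Set.Ioi 0)) :
    ContDiffOn ℝ n (radialPot m g) (Set.Ioi 0) := by
  refine contDiffOn_radialPot_of_primitive hg hm fun q hq => ?_
  have hprim : ContDiffOn ℝ (n + 1 : ℕ) (fun R => ∫ s in (1 : ℝ)..R, q s * g' s) (Set.Ioi 0) :=
    contDiffOn_succ_of_hasDerivAt isOpen_Ioi (hq.mul hg') fun x hx =>
      hasDerivAt_primitive_of_continuousOn isOpen_Ioi (hq.mul hg').continuousOn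
        (Set.mem_Ioi.2 one_pos) hx
  refine (hprim.of_le (by exact_mod_cast n.le_succ)).congr fun R hR => ?_
  refine intervalIntegral.integral_congr_ae ?_
  filter_upwards [(ae_restrict_iff' measurableSet_Ioi).1 hgg'] with s hs hs1
  rw [hs ((lt_min one_pos hR).trans hs1.1)]

theorem exists_contDiffOn_of_weak_deriv_eq_mul_radialPot {ν q : ℝ → ℂ} (hg : RadialL2 g)
    (hm : 2 ≤ m) (hν : ContDiffOn ℝ ∞ ν (Set.Ioi 0)) (hν0 : ∀ s ∈ Set.Ioi 0, ν s ≠ 0)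
    (hq : ContDiffOn ℝ ∞ q (Set.Ioi 0))
    (h : ∀ F : 𝓓(halfLine, ℝ),
      ∫ s, deriv F s • (ν s * g s) = -∫ s, F s • (q s * radialPot m g s)) :
    ∃ u : ℝ → ℂ, (g =ᵐ[volume.restrict (Set.Ioi 0)] fun s => u s / ν s) ∧
      ContDiffOn ℝ ∞ u (Set.Ioi 0) ∧
      ∀ s ∈ Set.Ioi 0, HasDerivAt u (q s * radialPot m g s) s := by
  obtain ⟨u, hu, hderiv⟩ := exists_ae_eq_hasDerivAt_of_weak_deriv (Ω := halfLine)
    Set.ordConnected_Ioi Set.nonempty_Ioi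
    (hg.locallyIntegrableOn.continuousOn_mul hν.continuousOn isOpen_Ioi.isLocallyClosed)
    (hq.continuousOn.mul (continuousOn_radialPot hg hm)) h
  have hgu : g =ᵐ[volume.restrict (Set.Ioi 0)] fun s => u s / ν s := by
    filter_upwards [hu, ae_restrict_mem measurableSet_Ioi] with s hs hs0
    rw [← hs, mul_div_cancel_left₀ _ (hν0 s hs0)]
  refine ⟨u, hgu, contDiffOn_infty.2 fun n => ?_, hderiv⟩
  induction n with
  | zero =>
    exact contDiffOn_zero.2 fun x hx => (hderiv x hx).continuousAt.continuousWithinAt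
  | succ n ih =>
    have hn : ((n : ℕ∞) : WithTop ℕ∞) ≤ ∞ := by exact_mod_cast le_top
    have hquot : ContDiffOn ℝ n (fun s => u s / ν s) (Set.Ioi 0) := by
      simp only [div_eq_mul_inv]
      exact ih.mul ((hν.of_le hn).inv hν0)
    exact contDiffOn_succ_of_hasDerivAt isOpen_Ioi
      ((hq.of_le hn).mul (contDiffOn_radialPot hg hm hgu hquot)) hderiv

end RadialPotentialRegularity

section IntegratingFactor

open scoped Distributions

/-- The integrating factor `exp (∫_1^s A)` of a linear first order equation on the half-line. -/
noncomputable def expPrimitive (A : ℝ → ℂ) (s : ℝ) : ℂ := Complex.exp (∫ t in (1 : ℝ)..s, A t)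

section ExpPrimitive

variable {A : ℝ → ℂ} {ζ : ℂ} {s t : ℝ}

theorem expPrimitive_ne_zero (A : ℝ → ℂ) (s : ℝ) : expPrimitive A s ≠ 0 := Complex.exp_ne_zero _

theorem hasDerivAt_expPrimitive (hA : ContinuousOn A (Set.Ioi 0)) (hs : 0 < s) :
    HasDerivAt (expPrimitive A) (expPrimitive A s * A s) s :=
  (hasDerivAt_primitive_of_continuousOn isOpen_Ioi hA (Set.mem_Ioi.2 one_pos) hs).cexp

theorem contDiffOn_expPrimitive (hA : ContDiffOn ℝ ∞ A (Set.Ioi 0)) :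
    ContDiffOn ℝ ∞ (expPrimitive A) (Set.Ioi 0) := by
  refine ContDiffOn.cexp (contDiffOn_infty.2 fun n => ?_)
  have hAn := contDiffOn_infty.1 hA n
  exact (contDiffOn_succ_of_hasDerivAt isOpen_Ioi hAn fun x hx =>
    hasDerivAt_primitive_of_continuousOn isOpen_Ioi hAn.continuousOn
      (Set.mem_Ioi.2 one_pos) hx).of_le (by exact_mod_cast n.le_succ)

theorem expPrimitive_of_eq_div (hA : ContinuousOn A (Set.Ioi 0)) (ht : 0 < t) (hts : t ≤ s)
    (h : ∀ τ ∈ Set.Icc t s, A τ = ζ / τ) :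
    expPrimitive A s = ((s / t : ℝ) : ℂ) ^ ζ * expPrimitive A t := by
  have hs : 0 < s := ht.trans_le hts
  have hint : ∀ {x y : ℝ}, 0 < x → 0 < y → IntervalIntegrable A volume x y := fun hx hy =>
    intervalIntegrable_of_locallyIntegrableOn (hA.locallyIntegrableOn measurableSet_Ioi)
      (Set.mem_Ioi.2 hx) (Set.mem_Ioi.2 hy)
  have hlog : ∫ τ in t..s, A τ = Real.log (s / t) * ζ := by
    have hcongr : ∫ τ in t..s, A τ = ∫ τ in t..s, ζ * ((1 / τ : ℝ) : ℂ) := by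
      refine intervalIntegral.integral_congr fun τ hτ => ?_
      rw [Set.uIcc_of_le hts] at hτ
      rw [h τ hτ, Complex.ofReal_div, Complex.ofReal_one, mul_one_div]
    rw [hcongr, intervalIntegral.integral_const_mul, intervalIntegral.integral_ofReal,
      integral_one_div_of_pos ht hs, mul_comm]
  rw [expPrimitive, expPrimitive, Complex.cpow_def_of_ne_zero
    (Complex.ofReal_ne_zero.2 (div_pos hs ht).ne'), ← Complex.ofReal_log (div_pos hs ht).le,
    ← hlog, ← Complex.exp_add, add_comm,
    intervalIntegral.integral_add_adjacent_intervals (hint one_pos ht) (hint ht hs)]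

theorem div_expPrimitive_of_eq_div (hA : ContinuousOn A (Set.Ioi 0)) (ht : 0 < t) (hts : t ≤ s)
    (h : ∀ τ ∈ Set.Icc t s, A τ = ζ / τ) (u : ℂ) :
    u / expPrimitive A t = ((s / t : ℝ) : ℂ) ^ ζ * (u / expPrimitive A s) := by
  have hst : ((s / t : ℝ) : ℂ) ^ ζ ≠ 0 :=
    Complex.cpow_ne_zero_iff.2 (.inl (Complex.ofReal_ne_zero.2 (div_pos (ht.trans_le hts) ht).ne'))
  rw [expPrimitive_of_eq_div hA ht hts h, mul_div_assoc', mul_div_mul_left _ _ hst]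

end ExpPrimitive

/-- The rate `A` for which `expPrimitive A` is an integrating factor of the radial equation
`b s g' + (κ + 2 b - i k α) g = -S` satisfied by the profile `g` of a solution `W` of mode `k` of
`div (V W) = κ W + S(R) e^{ikθ}`, where `V = X (i α - b)`. -/
noncomputable def transportRate (α : ℝ → ℝ) (b : ℝ) (κ : ℂ) (k : ℤ) (s : ℝ) : ℂ :=
  (κ + 2 * b - Complex.I * k * α s) / (b * s)

variable {α : ℝ → ℝ} {b : ℝ} {κ : ℂ} {k : ℤ}

theorem contDiffOn_transportRate (hb : b ≠ 0) (hα : ContDiffOn ℝ ∞ α (Set.Ioi 0)) (κ : ℂ) (k : ℤ) :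
    ContDiffOn ℝ ∞ (transportRate α b κ k) (Set.Ioi 0) := by
  unfold transportRate
  simp only [div_eq_mul_inv]
  refine (contDiffOn_const.sub (contDiffOn_const.mul
    (Complex.ofRealCLM.contDiff.comp_contDiffOn hα))).mul ?_
  exact (contDiff_const.mul Complex.ofRealCLM.contDiff).contDiffOn.inv fun s hs =>
    mul_ne_zero (Complex.ofReal_ne_zero.2 hb) (Complex.ofReal_ne_zero.2 (ne_of_gt hs))

variable {ν g S : ℝ → ℂ}

theorem continuousOn_div_ofReal (hν : ContinuousOn ν (Set.Ioi 0)) :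
    ContinuousOn (fun s => ν s / s) (Set.Ioi 0) := by
  simpa only [pow_one, contDiffOn_zero] using contDiffOn_div_ofReal_pow 1 (contDiffOn_zero.2 hν)

theorem mul_deriv_testFunction_smul_div_sq (hb : b ≠ 0) {s : ℝ} (hs : 0 < s)
    (hν : HasDerivAt ν (ν s * transportRate α b κ k s) s) (F : 𝓓(halfLine, ℝ)) (z : ℂ) :
    s * (z * (-b * s * deriv (fun s => F s • (ν s / s ^ 2)) s -
      Complex.I * k * α s * (F s • (ν s / s ^ 2)))) =
    -b * (deriv F s • (ν s * z)) - κ * (F s • (ν s / s * z)) := by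
  have hs0 : (s : ℂ) ≠ 0 := Complex.ofReal_ne_zero.2 hs.ne'
  have hbc : (b : ℂ) ≠ 0 := Complex.ofReal_ne_zero.2 hb
  have hsq : HasDerivAt (fun s : ℝ => (s : ℂ) ^ 2) (2 * s) s := by
    simpa using (hasDerivAt_id s).ofReal_comp.fun_pow 2
  have hderiv := (F.contDiff.differentiable (by simp) s).hasDerivAt.fun_smul
    (hν.fun_div hsq (pow_ne_zero 2 hs0))
  rw [hderiv.deriv]
  simp only [Complex.real_smul, transportRate]
  field_simp
  ring

theorem setIntegral_mul_deriv_testFunction_smul_div_sq (hb : b ≠ 0)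
    (hν : ∀ s ∈ Set.Ioi 0, HasDerivAt ν (ν s * transportRate α b κ k s) s)
    (hg : LocallyIntegrableOn g (Set.Ioi 0)) (F : 𝓓(halfLine, ℝ)) :
    ∫ s in Set.Ioi (0 : ℝ), s * (g s * (-b * s * deriv (fun s => F s • (ν s / s ^ 2)) s -
      Complex.I * k * α s * (F s • (ν s / s ^ 2)))) =
    -b * (∫ s, deriv F s • (ν s * g s)) - κ * ∫ s, F s • (ν s / s * g s) := by
  have hν_cont : ContinuousOn ν (Set.Ioi 0) := HasDerivAt.continuousOn hν
  have hdF := integrable_deriv_testFunction_smul F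
    (hg.continuousOn_mul hν_cont isOpen_Ioi.isLocallyClosed)
  have hF := integrable_testFunction_smul F
    (hg.continuousOn_mul (continuousOn_div_ofReal hν_cont) isOpen_Ioi.isLocallyClosed)
  rw [setIntegral_congr_fun measurableSet_Ioi fun s hs =>
      mul_deriv_testFunction_smul_div_sq hb hs (hν s hs) F (g s),
    integral_sub (hdF.integrableOn.const_mul _) (hF.integrableOn.const_mul _),
    integral_const_mul, integral_const_mul, ← setIntegral_testFunction_smul,
    ← setIntegral_deriv_testFunction_smul]
  rfl

theorem setIntegral_mul_testFunction_smul_div_sq (hν : ContinuousOn ν (Set.Ioi 0))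
    (hg : LocallyIntegrableOn g (Set.Ioi 0)) (hS : LocallyIntegrableOn S (Set.Ioi 0))
    (F : 𝓓(halfLine, ℝ)) :
    ∫ s in Set.Ioi (0 : ℝ), s * ((κ * g s + S s) * (F s • (ν s / s ^ 2))) =
    κ * (∫ s, F s • (ν s / s * g s)) + ∫ s, F s • (ν s / s * S s) := by
  have hint : ∀ {p : ℝ → ℂ}, LocallyIntegrableOn p (Set.Ioi 0) →
      Integrable fun s => F s • (ν s / s * p s) := fun hp =>
    integrable_testFunction_smul F
      (hp.continuousOn_mul (continuousOn_div_ofReal hν) isOpen_Ioi.isLocallyClosed)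
  calc
    _ = ∫ s in (halfLine : Set ℝ), F s • (κ * (ν s / s * g s) + ν s / s * S s) := by
      refine setIntegral_congr_fun measurableSet_Ioi fun s hs => ?_
      have hs0 : (s : ℂ) ≠ 0 := Complex.ofReal_ne_zero.2 (ne_of_gt hs)
      simp only [Complex.real_smul]
      field_simp
    _ = ∫ s, (κ * (F s • (ν s / s * g s)) + F s • (ν s / s * S s)) := by
      rw [setIntegral_testFunction_smul]
      simp only [smul_add, mul_smul_comm]
    _ = _ := by rw [integral_add ((hint hg).const_mul κ) (hint hS), integral_const_mul]

theorem integral_deriv_testFunction_smul_of_isWeakDiv {V W D : ℂ → ℂ} (hb : b ≠ 0)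
    (hV : ∀ X ≠ 0, V X = X * (Complex.I * α ‖X‖ - b)) (hν : ContDiffOn ℝ ∞ ν (Set.Ioi 0))
    (hν' : ∀ s ∈ Set.Ioi 0, HasDerivAt ν (ν s * transportRate α b κ k s) s)
    (hg : LocallyIntegrableOn g (Set.Ioi 0)) (hS : LocallyIntegrableOn S (Set.Ioi 0))
    (hW : W =ᵐ[volume] modeFun g k) (hD : D =ᵐ[volume] modeFun (fun s => κ * g s + S s) k)
    (hWD : IsWeakDiv V W D) (F : 𝓓(halfLine, ℝ)) :
    ∫ s, deriv F s • (ν s * g s) = -∫ s, F s • (-(ν s / s / b) * S s) := by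
  -- One factor `s` compensates the area element, the other the weight of `∂_s` in `V · ∇`.
  have htsupp : tsupport (fun s => F s • (ν s / (s : ℂ) ^ 2)) ⊆ tsupport F :=
    tsupport_smul_subset_left _ _
  have hweak := integral_radial_of_isWeakDiv hV hW hD hWD
    (contDiff_testFunction_smul F (contDiffOn_div_ofReal_pow 2 hν))
    F.hasCompactSupport.smul_right (htsupp.trans F.tsupport_subset)
  rw [setIntegral_mul_deriv_testFunction_smul_div_sq hb hν' hg,
    setIntegral_mul_testFunction_smul_div_sq hν.continuousOn hg hS] at hweak
  have hbc : (b : ℂ) ≠ 0 := Complex.ofReal_ne_zero.2 hb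
  have hq : ∫ s, F s • (-(ν s / s / b) * S s) = -(b : ℂ)⁻¹ * ∫ s, F s • (ν s / s * S s) := by
    rw [← integral_const_mul]
    congr 1 with s
    simp only [Complex.real_smul]
    field_simp
  rw [hq, neg_mul, neg_neg, eq_inv_mul_iff_mul_eq₀ hbc]
  linear_combination -hweak

end IntegratingFactor

section EigenfunctionProfile

theorem RadialL2.nonpos_of_ae_le_norm {g : ℝ → ℂ} (hg : RadialL2 g) {r κ : ℝ} (hr : 0 < r)
    (hκ : ∀ᵐ s ∂volume.restrict (Set.Ioi r), κ ≤ ‖g s‖) : κ ≤ 0 := by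
  by_contra! hκ0
  have hconst : IntegrableOn (fun _ : ℝ => r * κ ^ 2) (Set.Ioi r) := by
    refine (hg.integrableOn_sq.mono_set (Set.Ioi_subset_Ioi hr.le)).mono' (by fun_prop) ?_
    filter_upwards [hκ, ae_restrict_mem measurableSet_Ioi] with s hs hrs
    rw [Real.norm_of_nonneg (by positivity)]
    exact mul_le_mul hrs.le (pow_le_pow_left₀ hκ0.le hs 2) (by positivity) (hr.trans hrs).le
  rw [integrableOn_const_iff, Real.volume_Ioi] at hconst
  simp [hr.ne', hκ0.ne'] at hconst

namespace VortexData

/-- The integrating factor of the radial equation satisfied by an element of `Ker (L_b - lam)` of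
mode `k`. -/
noncomputable def modeFactor (P : VortexData) (a b : ℝ) (lam : ℂ) (k : ℤ) : ℝ → ℂ :=
  expPrimitive (transportRate (fun s => P.vθ s / s) b (a * b - 2 * b - lam) k)

namespace Admissible

variable {P : VortexData} {a b : ℝ} {lam : ℂ} {k : ℤ}

theorem contDiffOn_modeRate (hP : P.Admissible) (hb : b ≠ 0) :
    ContDiffOn ℝ ∞ (transportRate (fun s => P.vθ s / s) b (a * b - 2 * b - lam) k) (Set.Ioi 0) :=
  contDiffOn_transportRate hb (hP.contDiffOn_vθ.div contDiffOn_id fun _ hs => ne_of_gt hs) _ _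

theorem contDiffOn_modeFactor (hP : P.Admissible) (hb : b ≠ 0) :
    ContDiffOn ℝ ∞ (P.modeFactor a b lam k) (Set.Ioi 0) :=
  contDiffOn_expPrimitive (hP.contDiffOn_modeRate hb)

theorem div_modeFactor_of_le (hP : P.Admissible) (hb : b ≠ 0) {s t : ℝ} (ht : 0 < t) (hts : t ≤ s)
    (hs : s ≤ P.r₁ - P.ε) (u : ℂ) :
    u / P.modeFactor a b lam k t =
      ((s / t : ℝ) : ℂ) ^ (a - lam / b - Complex.I * (k * P.c / (2 * b) : ℝ)) *
        (u / P.modeFactor a b lam k s) := by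
  refine div_expPrimitive_of_eq_div (hP.contDiffOn_modeRate hb).continuousOn ht hts
    (fun τ hτ => ?_) u
  have hτ0 : (τ : ℂ) ≠ 0 := Complex.ofReal_ne_zero.2 (ht.trans_le hτ.1).ne'
  have hbc : (b : ℂ) ≠ 0 := Complex.ofReal_ne_zero.2 hb
  rw [transportRate, hP.vθ_of_le (hτ.2.trans hs)]
  push_cast
  field_simp
  ring

theorem div_modeFactor_of_ge (hP : P.Admissible) (hb : b ≠ 0) {s t : ℝ} (ht : P.r₂ + P.ε ≤ t)
    (hts : t ≤ s) (u : ℂ) :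
    u / P.modeFactor a b lam k t =
      ((s / t : ℝ) : ℂ) ^ (a - lam / b) * (u / P.modeFactor a b lam k s) := by
  have ht0 : 0 < t := by linarith [hP.r₁_pos, hP.r₁_lt_r₂, hP.ε_pos]
  refine div_expPrimitive_of_eq_div (hP.contDiffOn_modeRate hb).continuousOn ht0 hts
    (fun τ hτ => ?_) u
  have hτ0 : (τ : ℂ) ≠ 0 := Complex.ofReal_ne_zero.2 (ht0.trans_le hτ.1).ne'
  have hbc : (b : ℂ) ≠ 0 := Complex.ofReal_ne_zero.2 hb
  rw [transportRate, hP.vθ_of_ge (ht.trans hτ.1), zero_div, Complex.ofReal_zero]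
  field_simp
  ring

section Radial

variable {W D : ℂ → ℂ} {g u v : ℝ → ℂ}

theorem exists_modeFactor_mul_hasDerivAt (hP : P.Admissible) (hb : b ≠ 0) (hk : 2 ≤ k.natAbs)
    (hL : MemLp W 2 volume) (hW : W =ᵐ[volume] modeFun g k) (hD : IsWeakDiv (P.Vb b) W D)
    (hE : ∀ᵐ X, (a * b : ℂ) * W X + -(D X + 2 * (b : ℂ) * W X) + P.K W X = lam * W X) :
    ∃ u v : ℝ → ℂ, (g =ᵐ[volume.restrict (Set.Ioi 0)] fun s => u s / P.modeFactor a b lam k s) ∧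
      ContDiffOn ℝ ∞ u (Set.Ioi 0) ∧
      ∀ s ∈ Set.Ioi 0, HasDerivAt u (((deriv P.w s : ℝ) : ℂ) * v s) s := by
  have hg := RadialL2.of_memLp hL hW
  have hν := hP.contDiffOn_modeFactor (a := a) (lam := lam) (k := k) hb
  have hν' : ∀ s ∈ Set.Ioi (0 : ℝ), HasDerivAt (P.modeFactor a b lam k) _ s := fun s hs =>
    hasDerivAt_expPrimitive (hP.contDiffOn_modeRate hb).continuousOn hs
  set A : ℝ → ℂ := fun s => -((deriv P.w s : ℝ) : ℂ) / s * (Complex.I * k.sign / 2) with hA_def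
  have hA : ContDiffOn ℝ ∞ A (Set.Ioi 0) := by
    have hw : ContDiffOn ℝ ∞ (fun s => ((deriv P.w s : ℝ) : ℂ)) (Set.Ioi 0) :=
      Complex.ofRealCLM.contDiff.comp_contDiffOn
        (hP.contDiffOn_w.deriv_of_isOpen isOpen_Ioi (by simp))
    simpa only [pow_one] using (contDiffOn_div_ofReal_pow 1 hw.neg).mul contDiffOn_const
  have hD_mode : D =ᵐ[volume] modeFun (fun s => (a * b - 2 * b - lam) * g s +
      A s * radialPot k.natAbs g s) k := by
    filter_upwards [hE, hW, hP.K_ae_eq_modeFun hk hL hW] with X hEX hWX hKX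
    rw [hKX, hWX] at hEX
    simp only [modeFun, hA_def] at hEX ⊢
    linear_combination -hEX
  have hq : ContDiffOn ℝ ∞ (fun s : ℝ => -(P.modeFactor a b lam k s / s / b) * A s)
      (Set.Ioi 0) := by
    simpa only [pow_one] using (((contDiffOn_div_ofReal_pow 1 hν).div_const (b : ℂ)).neg).mul hA
  obtain ⟨u, hgu, hu, hderiv⟩ := exists_contDiffOn_of_weak_deriv_eq_mul_radialPot hg hk hν
    (fun _ _ => expPrimitive_ne_zero _ _) hq fun F => by
      have hS : LocallyIntegrableOn (fun s => A s * radialPot k.natAbs g s) (Set.Ioi 0) :=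
        (hA.continuousOn.mul (continuousOn_radialPot hg hk)).locallyIntegrableOn measurableSet_Ioi
      simpa only [mul_assoc] using integral_deriv_testFunction_smul_of_isWeakDiv hb
        (fun X hX => P.Vb_eq b hX) hν hν' hg.locallyIntegrableOn hS hW hD_mode hD F
  refine ⟨u, fun s => P.modeFactor a b lam k s / s / b * (s : ℂ)⁻¹ * (Complex.I * k.sign / 2) *
    radialPot k.natAbs g s, hgu, hu, fun s hs => ?_⟩
  convert hderiv s hs using 1
  rw [hA_def]
  ring

theorem exists_eq_const_of_lt (hP : P.Admissible)
    (hu : ∀ s ∈ Set.Ioi 0, HasDerivAt u (((deriv P.w s : ℝ) : ℂ) * v s) s) :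
    ∃ κ, ∀ s, 0 < s → s < P.r₁ - P.ε → u s = κ := by
  obtain ⟨κ, hκ⟩ := isOpen_Ioo.exists_is_const_of_deriv_eq_zero
    (isPreconnected_Ioo (a := 0) (b := P.r₁ - P.ε))
    (fun s hs => (hu s hs.1).differentiableAt.differentiableWithinAt) fun s hs => by
      rw [(hu s hs.1).deriv, hP.deriv_w_of_lt hs.1 hs.2, Complex.ofReal_zero, zero_mul,
        Pi.zero_apply]
  exact ⟨κ, fun s hs0 hs => hκ s ⟨hs0, hs⟩⟩

theorem exists_eq_const_of_gt (hP : P.Admissible)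
    (hu : ∀ s ∈ Set.Ioi 0, HasDerivAt u (((deriv P.w s : ℝ) : ℂ) * v s) s) :
    ∃ κ, ∀ s, P.r₂ + P.ε < s → u s = κ := by
  have hpos : 0 < P.r₂ + P.ε := by linarith [hP.r₁_pos, hP.r₁_lt_r₂, hP.ε_pos]
  obtain ⟨κ, hκ⟩ := isOpen_Ioi.exists_is_const_of_deriv_eq_zero
    (isPreconnected_Ioi (a := P.r₂ + P.ε))
    (fun s hs => (hu s (hpos.trans hs)).differentiableAt.differentiableWithinAt) fun s hs => by
      rw [(hu s (hpos.trans hs)).deriv, hP.deriv_w_of_gt hs, Complex.ofReal_zero, zero_mul,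
        Pi.zero_apply]
  exact ⟨κ, hκ⟩

theorem div_modeFactor_mul_of_lt (hP : P.Admissible)
    (hu : ∀ s ∈ Set.Ioi 0, HasDerivAt u (((deriv P.w s : ℝ) : ℂ) * v s) s) (hb : b ≠ 0)
    {s t : ℝ} (hs : 0 < s) (hsr : s < P.r₁ - P.ε) (ht : 0 < t) (ht1 : t ≤ 1) :
    u (t * s) / P.modeFactor a b lam k (t * s) =
      (t : ℂ) ^ (lam / b - a + Complex.I * (k * P.c / (2 * b) : ℝ)) *
        (u s / P.modeFactor a b lam k s) := by
  obtain ⟨κ, hκ⟩ := hP.exists_eq_const_of_lt hu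
  have hts : t * s ≤ s := mul_le_of_le_one_left hs.le ht1
  rw [hκ s hs hsr, hκ (t * s) (mul_pos ht hs) (hts.trans_lt hsr),
    hP.div_modeFactor_of_le hb (mul_pos ht hs) hts hsr.le, div_mul_cancel_right₀ hs.ne',
    Complex.ofReal_inv, Complex.inv_cpow _ _ (by simp [Complex.arg_ofReal_of_nonneg ht.le,
      Real.pi_ne_zero.symm]), ← Complex.cpow_neg]
  congr 2
  ring

theorem div_modeFactor_eq_zero_of_gt (hP : P.Admissible)
    (hu : ∀ s ∈ Set.Ioi 0, HasDerivAt u (((deriv P.w s : ℝ) : ℂ) * v s) s) (hb : 0 < b)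
    (hlam : a * b ≤ lam.re) (hg : RadialL2 g)
    (hgu : g =ᵐ[volume.restrict (Set.Ioi 0)] fun s => u s / P.modeFactor a b lam k s) {r : ℝ}
    (hr : P.r₂ + P.ε < r) : u r / P.modeFactor a b lam k r = 0 := by
  obtain ⟨κ, hκ⟩ := hP.exists_eq_const_of_gt hu
  have hr0 : 0 < r := by linarith [hP.r₁_pos, hP.r₁_lt_r₂, hP.ε_pos]
  have hre : (a - lam / b : ℂ).re ≤ 0 := by
    simpa [Complex.div_ofReal_re] using (le_div_iff₀ hb).2 hlam
  have hgrow : ∀ s, r < s →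
      ‖u r / P.modeFactor a b lam k r‖ ≤ ‖u s / P.modeFactor a b lam k s‖ := fun s hs => by
    rw [hκ r hr, hκ s (hr.trans hs), hP.div_modeFactor_of_ge hb.ne' hr.le hs.le, norm_mul,
      Complex.norm_cpow_eq_rpow_re_of_pos (div_pos (hr0.trans hs) hr0)]
    exact mul_le_of_le_one_left (norm_nonneg _)
      (Real.rpow_le_one_of_one_le_of_nonpos ((one_le_div hr0).2 hs.le) hre)
  refine norm_le_zero_iff.1 (hg.nonpos_of_ae_le_norm hr0 ?_)
  filter_upwards [ae_restrict_of_ae_restrict_of_subset (Set.Ioi_subset_Ioi hr0.le) hgu,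
    ae_restrict_mem measurableSet_Ioi] with s hs hrs
  exact (hgrow s hrs).trans_eq (congrArg norm hs.symm)

theorem isHomogNearZero_modeFun_div_modeFactor (hP : P.Admissible)
    (hu : ∀ s ∈ Set.Ioi 0, HasDerivAt u (((deriv P.w s : ℝ) : ℂ) * v s) s) (hb : 0 < b)
    (hlam : a * b ≤ lam.re) (hg : RadialL2 g)
    (hgu : g =ᵐ[volume.restrict (Set.Ioi 0)] fun s => u s / P.modeFactor a b lam k s)
    (husmooth : ContDiffOn ℝ ∞ u (Set.Ioi 0)) :
    IsHomogNearZero (lam / b - a + Complex.I * (k * P.c / (2 * b) : ℝ))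
      (modeFun (fun s => u s / P.modeFactor a b lam k s) k) := by
  have hsmooth : ContDiffOn ℝ ∞ (fun s => u s / P.modeFactor a b lam k s) (Set.Ioi 0) := by
    simp only [div_eq_mul_inv]
    exact husmooth.mul ((hP.contDiffOn_modeFactor hb.ne').inv fun _ _ => expPrimitive_ne_zero _ _)
  exact isHomogNearZero_modeFun k hsmooth
    (fun r hr => hP.div_modeFactor_eq_zero_of_gt hu hb hlam hg hgu hr)
    (sub_pos.2 hP.ε_lt_r₁)
    (fun s t hs hsr ht ht1 => hP.div_modeFactor_mul_of_lt hu hb.ne' hs hsr ht ht1)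

end Radial

end Admissible

end VortexData

end EigenfunctionProfile

theorem mainTheorem7_general {P : VortexData} (hP : P.Admissible) {a b : ℝ} (hb : 0 < b)
    {lam : ℂ} (hlam : a * b < lam.re) {k : ℤ} (hk : 2 ≤ k.natAbs) {W D : ℂ → ℂ} (hW : W ∈ U k)
    (hD : IsWeakDiv (P.Vb b) W D)
    (hE : ∀ᵐ X, (a * b : ℂ) * W X + -(D X + 2 * (b : ℂ) * W X) + P.K W X = lam * W X) :
    ∃ W' : ℂ → ℂ, W' =ᵐ[volume] W ∧
      ContDiffOn ℝ ∞ W' {0}ᶜ ∧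
      HasCompactSupport W' ∧
      IsHolderClass (lam.re / b - a) W' := by
  obtain ⟨hL, g, hWg : W =ᵐ[volume] modeFun g k⟩ := hW
  have hk0 : k ≠ 0 := by lia
  obtain ⟨u, v, hgu, husmooth, hu⟩ := hP.exists_modeFactor_mul_hasDerivAt hb.ne' hk hL hWg hD hE
  have hhom := hP.isHomogNearZero_modeFun_div_modeFactor hu hb hlam.le (.of_memLp hL hWg) hgu
    husmooth (k := k)
  have hre : (lam / b - a + Complex.I * (k * P.c / (2 * b) : ℝ)).re = lam.re / b - a := by
    rw [Complex.add_re, Complex.I_mul_re, Complex.ofReal_im]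
    simp [Complex.div_ofReal_re]
  have hae : modeFun (fun s => u s / P.modeFactor a b lam k s) k =ᵐ[volume] W := by
    filter_upwards [hWg, ae_eq_comp_norm hgu] with X hX hgX
    rw [hX, modeFun, modeFun, hgX]
  refine ⟨_, hae, hhom.contDiffOn, hhom.hasCompactSupport, hre ▸ hhom.isHolderClass ?_ ?_⟩
  · simp [modeFun, zero_zpow _ hk0]
  · rw [hre, sub_pos, lt_div_iff₀ hb]
    exact hlam

theorem mainTheorem7 (P : VortexData) (hP : P.Admissible)
    (a b : ℝ) (ha : 0 < a) (ha' : a ≤ 1) (hb : 0 < b) (hb' : b ≤ 1)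
    (n : ℕ) (hn : 2 ≤ n) (lam : ℂ) (hlam : 3 * b < lam.re)
    (j : ℤ) (hj : j ≠ 0) (W : ℂ → ℂ) (hW : W ∈ P.kerLb a b n lam ∩ U (j * n)) :
    2 ≤ lam.re / b - a ∧
    ∃ W' : ℂ → ℂ, W' =ᵐ[volume] W ∧
      ContDiffOn ℝ ∞ W' {0}ᶜ ∧
      HasCompactSupport W' ∧
      IsHolderClass (lam.re / b - a) W' := by
  obtain ⟨⟨-, D, -, hD, hE⟩, hWU⟩ := hW
  have hγ : 3 < lam.re / b := (lt_div_iff₀ hb).2 hlam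
  have hk : 2 ≤ (j * n).natAbs := by
    rw [Int.natAbs_mul, Int.natAbs_natCast]
    exact hn.trans (Nat.le_mul_of_pos_left n (Int.natAbs_pos.2 hj))
  exact ⟨by linarith, mainTheorem7_general hP hb (by nlinarith) hk hWU hD hE⟩
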